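/- Let $(\mathcal M,\mathfrak g)$ be a smooth, geodesically complete Riemannian manifold (finite-dimensional, without boundary), so that the exponential map $\mathrm{Exp}_x$ is defined on all of $T_x\mathcal M$ for every $x\in\mathcal M$. Norms and inner products of tangent vectors are those of $\mathfrak g$, $\nabla$ denotes the Riemannian gradient, and parallel transport is that of the Levi-Civita connection. A differentiable function $h:\mathcal M\to\mathbb R$ is called $L$-g-smooth if for every geodesic $\gamma$, with $x=\gamma(0)$, $y=\gamma(1)$ and $v=\dot\gamma(0)$ (so that $y=\mathrm{Exp}_x(v)$, i.e. $v=\mathrm{Exp}_x^{-1}(y)$ if geodesics are unique), $$\|\nabla h(x)-\Gamma_y^x\nabla h(y)\|\le L\|v\|,$$ where $\Gamma_y^x:T_y\mathcal M\to T_x\mathcal M$ is the parallel transport along $\gamma$. Let $f_1,\dots,f_n:\mathcal M\to\mathbb R$ be differentiable and $L$-g-smooth with $L>0$, let $f=\frac1n\sum_{i=1}^n f_i$, and let $f^*\in\mathbb R$ satisfy $f(x)\ge f^*$ for all $x\in\mathcal M$. Let $x^0\in\mathcal M$, $p\in(0,1]$, $B=n$, let $b$ be an integer with $1\le b<B$,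 and let $$0<\eta\le\frac{1}{L\left(1+\sqrt{\frac{1-p}{pb}}\right)}.$$ For an integer $m$ with $1\le m\le n$ let $\nabla f_m(x)=\frac1m\sum_{i\in S}\nabla f_i(x)$ be the minibatch gradient, where $S$ is a uniformly random $m$-element subset of $\{1,\dots,n\}$ (so $\nabla f_B=\nabla f$ for $B=n$). The R-PAGE method sets $g^0=\nabla f_B(x^0)$ and, for $k=0,1,2,\dots$, $x^{k+1}=\mathrm{Exp}_{x^k}(-\eta g^k)$ and $$g^{k+1}=\begin{cases}\nabla f_B(x^{k+1}) & \text{with probability } p,\\ \Gamma_{x^k}^{x^{k+1}}(g^k)+\nabla f_b(x^{k+1})-\Gamma_{x^k}^{x^{k+1}}\big(\nabla f_b(x^k)\big) & \text{otherwise,}\end{cases}$$ where $\Gamma_{x^k}^{x^{k+1}}$ is the parallel transport along the geodesic $t\mapsto\mathrm{Exp}_{x^k}(-t\eta g^k)$, $t\in[0,1]$, the same minibatch is used in both terms $\nabla f_b$, and all coins and minibatches are mutually independent. Let $K\ge1$ and let $\widehat x^K$ be chosen uniformly at random from $x^0,\dots,x^{K-1}$, independently of the coins and minibatches. Then $\|\nabla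 f(\widehat x^K)\|^2$ is integrable and $$\mathbb E\left[\|\nabla f(\widehat x^K)\|^2\right]\le\frac{2\,(f(x^0)-f^*)}{\eta K}.$$ -/

import Mathlib

open MeasureTheory ProbabilityTheory Bundle
open scoped Manifold ContDiff

noncomputable section

namespace RPage

/-! ### Geodesics and parallel transport on a Riemannian manifold

`M` is a manifold without boundary modelled on the finite-dimensional space `E`; the Riemannian
metric is Mathlib's inner product on the fibres of the tangent bundle. -/

section Geometry

variable {E : Type*} [NormedAddCommGroup E] [NormedSpace ℝ E]
  {M : Type*} [TopologicalSpace M] [ChartedSpace E M]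

/-- The velocity `γ'(t) ∈ T_{γ t} M` of a curve. -/
def velocity (E : Type*) [NormedAddCommGroup E] [NormedSpace ℝ E] {M : Type*}
    [TopologicalSpace M] [ChartedSpace E M] (γ : ℝ → M) (t : ℝ) :
    TangentSpace 𝓘(ℝ, E) (γ t) :=
  mfderiv 𝓘(ℝ, ℝ) 𝓘(ℝ, E) γ t (1 : ℝ)

/-- The components of a tangent vector `v ∈ T_x M` in the chart `chartAt E c`. -/
def chartComponents (c : M) {x : M} (v : TangentSpace 𝓘(ℝ, E) x) : E :=
  mfderiv 𝓘(ℝ, E) 𝓘(ℝ, E) (chartAt E c) x v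

section Metric

variable [RiemannianBundle (fun x : M ↦ TangentSpace 𝓘(ℝ, E) x)]

/-- The Riemannian metric read in the chart `chartAt E c`, at the coordinate point `u`:
the bilinear form with matrix `g_{ij}(u)`. -/
def chartMetric (c : M) (u a b : E) : ℝ :=
  inner ℝ (mfderiv 𝓘(ℝ, E) 𝓘(ℝ, E) (chartAt E c).symm u a :
      TangentSpace 𝓘(ℝ, E) ((chartAt E c).symm u))
    (mfderiv 𝓘(ℝ, E) 𝓘(ℝ, E) (chartAt E c).symm u b)

/-- The Christoffel symbols of the first kind of the Levi-Civita connection in the chart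
`chartAt E c`: `Γ(a, b; w) = (∂_a g(b, w) + ∂_b g(a, w) - ∂_w g(a, b)) / 2`. -/
def christoffel (c : M) (u a b w : E) : ℝ :=
  (fderiv ℝ (fun u' ↦ chartMetric c u' b w) u a
    + fderiv ℝ (fun u' ↦ chartMetric c u' a w) u b
    - fderiv ℝ (fun u' ↦ chartMetric c u' a b) u w) / 2

/-- The vector field `V` along the curve `γ` is parallel for the Levi-Civita connection. In every
chart around every point of the curve, the components of `V` satisfy
`dVᵏ/dt + Γᵏᵢⱼ γ'ⁱ Vʲ = 0`, written here with the index `k` lowered by the metric. -/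
def IsParallelAlong (γ : ℝ → M) (V : ∀ t, TangentSpace 𝓘(ℝ, E) (γ t)) : Prop :=
  ∀ (t : ℝ) (c : M), γ t ∈ (chartAt E c).source →
    ∃ V' : E, HasDerivAt (fun s ↦ chartComponents c (V s)) V' t ∧
      ∀ w : E, chartMetric c (chartAt E c (γ t)) V' w
        + christoffel c (chartAt E c (γ t)) (chartComponents c (velocity E γ t))
            (chartComponents c (V t)) w = 0

variable (E) in
/-- `γ : ℝ → M` is a geodesic: a smooth curve whose velocity is parallel along it. -/
def IsGeodesic (γ : ℝ → M) : Prop :=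
  ContMDiff 𝓘(ℝ, ℝ) 𝓘(ℝ, E) ∞ γ ∧ IsParallelAlong γ (velocity E γ)

/-- `γ` is a geodesic with `γ(0) = x` and `γ'(0) = v`. -/
def IsGeodesicFrom (γ : ℝ → M) (x : M) (v : TangentSpace 𝓘(ℝ, E) x) : Prop :=
  IsGeodesic E γ ∧ (⟨γ 0, velocity E γ 0⟩ : TangentBundle 𝓘(ℝ, E) M) = ⟨x, v⟩

variable (E M) in
/-- Every geodesic extends to all times, i.e. `Exp_x` is defined on all of `T_x M` for all `x`. -/
def GeodesicallyComplete : Prop :=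
  ∀ (x : M) (v : TangentSpace 𝓘(ℝ, E) x), ∃ γ : ℝ → M, IsGeodesicFrom γ x v

open Classical in
/-- The geodesic with initial point `x` and initial velocity `v`
(constant if there is none, which does not occur on a complete manifold). -/
def geodesicFrom (x : M) (v : TangentSpace 𝓘(ℝ, E) x) : ℝ → M :=
  if h : ∃ γ : ℝ → M, IsGeodesicFrom γ x v then h.choose else fun _ ↦ x

/-- The exponential map `Exp_x : T_x M → M`. -/
def riemExp (x : M) (v : TangentSpace 𝓘(ℝ, E) x) : M := geodesicFrom x v 1

open Classical in
/-- Parallel transport along `γ` from time `s` to time `t` of a tangent vector `v` at `γ s`: the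
value at `t` of the parallel field along `γ` whose value at `s` is `v`. -/
def parallelTransport (γ : ℝ → M) (s t : ℝ) (v : TangentBundle 𝓘(ℝ, E) M) :
    TangentSpace 𝓘(ℝ, E) (γ t) :=
  if h : ∃ V : ∀ r, TangentSpace 𝓘(ℝ, E) (γ r), IsParallelAlong γ V ∧
      (⟨γ s, V s⟩ : TangentBundle 𝓘(ℝ, E) M) = v
  then h.choose t else 0

/-- The parallel transport `T_x M → T_y M`, `y = Exp_x(v)`, along the geodesic
`t ↦ Exp_x(t v)`, `t ∈ [0, 1]`. -/
def expTransport (x : M) (v w : TangentSpace 𝓘(ℝ, E) x) :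
    TangentSpace 𝓘(ℝ, E) (riemExp x v) :=
  parallelTransport (geodesicFrom x v) 0 1 ⟨x, w⟩

section Gradient

variable [FiniteDimensional ℝ E]

instance (x : M) : FiniteDimensional ℝ (TangentSpace 𝓘(ℝ, E) x) :=
  inferInstanceAs (FiniteDimensional ℝ E)

instance (x : M) : CompleteSpace (TangentSpace 𝓘(ℝ, E) x) :=
  FiniteDimensional.complete ℝ _

variable (E) in
/-- The Riemannian gradient: `⟪∇f(x), v⟫ = df_x(v)` for all `v ∈ T_x M`. -/
def riemGrad (f : M → ℝ) (x : M) : TangentSpace 𝓘(ℝ, E) x :=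
  (InnerProductSpace.toDual ℝ (TangentSpace 𝓘(ℝ, E) x)).symm (mfderiv 𝓘(ℝ, E) 𝓘(ℝ, ℝ) f x)

variable (E) in
/-- `f` is differentiable and geodesically `L`-smooth: for every geodesic `γ`, with `x = γ(0)`,
`y = γ(1)` and `v = γ'(0)`, so that `Exp_x(v) = y`,
one has `‖∇f(x) - Γ_y^x ∇f(y)‖ ≤ L ‖v‖`, where `Γ_y^x` is the parallel transport along `γ`.
If geodesics between two points are unique then `v = Exp_x⁻¹(y)`. -/
def GSmooth (L : ℝ) (f : M → ℝ) : Prop :=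
  MDifferentiable 𝓘(ℝ, E) 𝓘(ℝ, ℝ) f ∧
    ∀ γ : ℝ → M, IsGeodesic E γ →
      ‖riemGrad E f (γ 0) - parallelTransport γ 1 0 ⟨γ 1, riemGrad E f (γ 1)⟩‖
        ≤ L * ‖velocity E γ 0‖

end Gradient

end Metric

end Geometry

/-! ### The random choices of the algorithm -/

/-- A minibatch of size `m`, drawn without replacement from `n` indices. -/
def Batch (n m : ℕ) : Type := {S : Finset (Fin n) // S.card = m}

instance (n m : ℕ) : MeasurableSpace (Batch n m) := ⊤

/-- What is drawn in one iteration: the coin (`true` means that a large minibatch is used), a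
large minibatch of size `B` and a small minibatch of size `b`. -/
abbrev Sample (n B b : ℕ) : Type := Bool × Batch n B × Batch n b

/-- The law of a coin that shows `true` with probability `p`. -/
def coinLaw (p : ℝ) : Measure Bool :=
  ENNReal.ofReal p • Measure.dirac true + ENNReal.ofReal (1 - p) • Measure.dirac false

/-- The law of one iteration's choices: coin and minibatches are independent, and the minibatches
are uniformly distributed. -/
def sampleLaw (n B b : ℕ) (p : ℝ) : Measure (Sample n B b) :=
  (coinLaw p).prod ((uniformOn (Set.univ : Set (Batch n B))).prod
    (uniformOn (Set.univ : Set (Batch n b))))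

/-- The randomness of `K` iterations: i.i.d. samples `ξ 0, ξ 1, …` and, independent of them, an
index `J` uniformly distributed on `{0, …, K - 1}`. -/
structure IsSampling {Ω : Type*} [MeasurableSpace Ω] (P : Measure Ω) {n B b K : ℕ} (p : ℝ)
    (ξ : ℕ → Ω → Sample n B b) (J : Ω → Fin K) : Prop where
  measurable_sample : ∀ k, Measurable (ξ k)
  law_sample : ∀ k, P.map (ξ k) = sampleLaw n B b p
  indep_samples : iIndepFun ξ P
  measurable_index : Measurable J
  law_index : P.map J = uniformOn Set.univ
  indep_index : IndepFun J (fun o k ↦ ξ k o) P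

/-! ### The algorithm -/

section Algorithm

/-- The finite-sum objective `f = (1/n) ∑ᵢ fᵢ`. -/
def objective {M : Type*} {n : ℕ} (f : Fin n → M → ℝ) (x : M) : ℝ :=
  (n : ℝ)⁻¹ * ∑ i, f i x

variable {E : Type*} [NormedAddCommGroup E] [NormedSpace ℝ E] [FiniteDimensional ℝ E]
  {M : Type*} [TopologicalSpace M] [ChartedSpace E M]
  [RiemannianBundle (fun x : M ↦ TangentSpace 𝓘(ℝ, E) x)]

variable (E) in
/-- The minibatch gradient `(1/m) ∑_{i ∈ S} ∇fᵢ(x)`, where `m` is the size of `S`. -/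
def batchGrad {n m : ℕ} (f : Fin n → M → ℝ) (S : Batch n m) (x : M) :
    TangentSpace 𝓘(ℝ, E) x :=
  (m : ℝ)⁻¹ • ∑ i ∈ S.1, riemGrad E (f i) x

/-- One iteration of R-PAGE, from `(xᵏ, gᵏ)` to `(xᵏ⁺¹, gᵏ⁺¹)`, with `xᵏ⁺¹ = Exp_{xᵏ}(-η gᵏ)`. -/
def rpageStep {n B b : ℕ} (f : Fin n → M → ℝ) (η : ℝ) (z : TangentBundle 𝓘(ℝ, E) M)
    (s : Sample n B b) : TangentBundle 𝓘(ℝ, E) M :=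
  let x : M := z.1
  let g : TangentSpace 𝓘(ℝ, E) x := z.2
  let v : TangentSpace 𝓘(ℝ, E) x := -(η • g)
  ⟨riemExp x v,
    if s.1 = true then batchGrad E f s.2.1 (riemExp x v)
    else expTransport x v g + batchGrad E f s.2.2 (riemExp x v)
      - expTransport x v (batchGrad E f s.2.2 x)⟩

variable (E) in
/-- The sequence `(xᵏ, gᵏ)` of R-PAGE for given outcomes `s` of the random choices;
`s 0` is used for `g⁰` and `s (k + 1)` for `gᵏ⁺¹`. -/
def rpage {n B b : ℕ} (f : Fin n → M → ℝ) (η : ℝ) (x₀ : M) (s : ℕ → Sample n B b) :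
    ℕ → TangentBundle 𝓘(ℝ, E) M
  | 0 => ⟨x₀, batchGrad E f (s 0).2.1 x₀⟩
  | k + 1 => rpageStep f η (rpage f η x₀ s k) (s (k + 1))

end Algorithm

end RPage

end

open RPage

open scoped NNReal Topology

set_option linter.unusedSectionVars false

/-! The potential Φ(x, g) = f(x) - f* + η/(2p) ‖g - ∇f(x)‖² drops in mean by at least η/2 ‖∇f(x)‖²
per iteration (`integral_potential_rpageStep_le`). The descent lemma along geodesics
(`GSmooth.le_add`), with v = -ηg and polarization, bounds the new value of f by f(x) - η/2 ‖∇f(x)‖²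
- η/2 (1 - Lη) ‖g‖² + η/2 ‖g - ∇f(x)‖². The estimator error vanishes with probability p; otherwise
its mean square is at most ‖g - ∇f(x)‖² + (Lη‖g‖)²/b (`avg_error_le`), because transport is a linear
isometry T and the error is T(g - ∇f(x)) plus a mean-zero sampling fluctuation of vectors of norm at
most Lη‖g‖. The weight η/(2p) cancels the error terms and the step size makes the coefficient of
‖g‖² nonpositive. Telescoping from Φ = f(x⁰) - f*, with Φ ≥ 0 at the end, gives the bound.

The geometry needed is that parallel transport exists for all times and is unique, linear and
isometric. In a chart it is a linear ODE; the transformation law of the Christoffel symbols makes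
local solutions chart independent, and a supremum argument extends them (`exists_isParallelAlong`).
Metric compatibility keeps inner products constant (`IsParallelAlong.inner_eq`), which also gives
uniqueness.

On the probabilistic side each iterate is a function of a finite history with finitely many values,
so integrability is automatic and independence reduces to Fubini on finite spaces. -/

namespace RPage

/-! ### Parallel fields in coordinates: linear ODEs and the Levi-Civita expression. -/

section Analysis

set_option maxSynthPendingDepth 3

variable {E : Type*} [NormedAddCommGroup E] [NormedSpace ℝ E]

/-- The linear equation `y' = A(t) y` can be solved near `t₀`, on an interval that depends neither
on the initial time nor on the initial value. -/
theorem exists_linear_ode_solution [CompleteSpace E] {A : ℝ → E →L[ℝ] E} {t₀ δ : ℝ} (hδ : 0 < δ)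
    (hA : ContinuousOn A (Set.Ioo (t₀ - δ) (t₀ + δ))) :
    ∃ ε > 0, ε ≤ δ ∧ ∀ s ∈ Set.Ioo (t₀ - ε) (t₀ + ε), ∀ v : E, ∃ y : ℝ → E, y s = v ∧
      ∀ t ∈ Set.Ioo (t₀ - ε) (t₀ + ε), HasDerivAt y (A t (y t)) t := by
  have hsub : Set.Icc (t₀ - δ / 2) (t₀ + δ / 2) ⊆ Set.Ioo (t₀ - δ) (t₀ + δ) := fun t ht ↦
    ⟨by linarith [ht.1], by linarith [ht.2]⟩
  obtain ⟨C, hC⟩ := isCompact_Icc.exists_bound_of_continuousOn (hA.mono hsub)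
  set D : ℝ≥0 := C.toNNReal + 1 with hD
  have hD1 : (1 : ℝ) ≤ D := by simp [hD]
  have hCD : C ≤ D := by
    rw [hD]; push_cast; linarith [Real.le_coe_toNNReal C]
  -- The solution stays in the ball of radius 2 and starts in that of radius 1; its speed is at most
  -- 2D and the time to an endpoint at most 2ε, so 4Dε ≤ 1 is what is needed.
  set ε : ℝ := min (δ / 2) (1 / (4 * D)) with hε
  have hε0 : 0 < ε := lt_min (by linarith) (by positivity)
  have hε2 : ε ≤ δ / 2 := min_le_left _ _
  have hε3 : ε * (4 * D) ≤ 1 := by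
    have : ε ≤ 1 / (4 * D) := min_le_right _ _
    rwa [le_div_iff₀ (by positivity)] at this
  refine ⟨ε, hε0, by linarith, fun s hs v ↦ ?_⟩
  have hsub' : Set.Icc (t₀ - ε) (t₀ + ε) ⊆ Set.Icc (t₀ - δ / 2) (t₀ + δ / 2) :=
    Set.Icc_subset_Icc (by linarith) (by linarith)
  have hbound : ∀ t ∈ Set.Icc (t₀ - ε) (t₀ + ε), ‖A t‖ ≤ D := fun t ht ↦
    (hC t (hsub' ht)).trans hCD
  have hPL : IsPicardLindelof (fun t x ↦ A t x)
      (⟨s, Set.Ioo_subset_Icc_self hs⟩ : Set.Icc (t₀ - ε) (t₀ + ε)) (0 : E) 2 1 (2 * D) D := by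
    refine ⟨fun t ht ↦ ?_, fun x _ ↦ ?_, fun t ht x hx ↦ ?_, ?_⟩
    · exact ((A t).lipschitz.weaken (by exact_mod_cast hbound t ht)).lipschitzOnWith
    · exact ((hA.mono (hsub'.trans hsub)).clm_apply continuousOn_const)
    · have hx' : ‖x‖ ≤ 2 := by simpa using hx
      calc ‖A t x‖ ≤ ‖A t‖ * ‖x‖ := (A t).le_opNorm x
        _ ≤ D * 2 := by gcongr; exact hbound t ht
        _ = ((2 * D : ℝ≥0) : ℝ) := by push_cast; ring
    · have : max (t₀ + ε - s) (s - (t₀ - ε)) ≤ 2 * ε :=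
        max_le (by linarith [hs.1]) (by linarith [hs.2])
      have h2 : (2 * (D : ℝ)) * max (t₀ + ε - s) (s - (t₀ - ε)) ≤ 2 * D * (2 * ε) := by gcongr
      push_cast
      nlinarith
  -- Only initial values in the unit ball are covered; by linearity, scaling `v` into it and the
  -- solution back removes the restriction without shrinking ε.
  obtain ⟨c, hc0, hc⟩ : ∃ c : ℝ, c ≠ 0 ∧ ‖c⁻¹ • v‖ ≤ 1 := by
    refine ⟨‖v‖ + 1, by positivity, ?_⟩
    rw [norm_smul, norm_inv, Real.norm_of_nonneg (by positivity), inv_mul_le_one₀ (by positivity)]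
    linarith
  obtain ⟨y, hy0, hy⟩ := hPL.exists_eq_forall_mem_Icc_hasDerivWithinAt
    (x := c⁻¹ • v) (by simpa using hc)
  refine ⟨c • y, ?_, fun t ht ↦ ?_⟩
  · simp only at hy0
    simp [hy0, hc0]
  · have := ((hy t (Set.Ioo_subset_Icc_self ht)).hasDerivAt (Icc_mem_nhds ht.1 ht.2)).const_smul c
    simpa using this

/-- The Levi-Civita expression in the first derivatives `D` of a metric. -/
noncomputable def leviCivita (D : E →L[ℝ] E →L[ℝ] E →L[ℝ] ℝ) (a b w : E) : ℝ :=
  (D a b w + D b a w - D w a b) / 2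

/-- Metric compatibility of the connection: the last two terms of the Levi-Civita expression are
antisymmetric in `b` and `w`. -/
theorem leviCivita_add_swap {D : E →L[ℝ] E →L[ℝ] E →L[ℝ] ℝ} (hD : ∀ a b w, D a b w = D a w b)
    (a b w : E) : leviCivita D a b w + leviCivita D a w b = D a b w := by
  simp only [leviCivita]
  rw [hD a w b, hD b a w, hD w a b]
  ring

set_option synthInstance.maxHeartbeats 200000 in
/-- The derivative of a metric that is the pullback of `G'` by `φ`. -/
theorem fderiv_pullback_form {F : Type*} [NormedAddCommGroup F] [NormedSpace ℝ F]
    {G : E → E →L[ℝ] E →L[ℝ] ℝ} {G' : F → F →L[ℝ] F →L[ℝ] ℝ} {φ : E → F} {u : E}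
    (hφ : ContDiffAt ℝ 2 φ u) (hG : DifferentiableAt ℝ G u) (hG' : DifferentiableAt ℝ G' (φ u))
    (hpull : ∀ᶠ z in 𝓝 u, ∀ a b, G z a b = G' (φ z) (fderiv ℝ φ z a) (fderiv ℝ φ z b))
    (a b w : E) :
    fderiv ℝ G u a b w =
      fderiv ℝ G' (φ u) (fderiv ℝ φ u a) (fderiv ℝ φ u b) (fderiv ℝ φ u w)
      + G' (φ u) (fderiv ℝ (fderiv ℝ φ) u a b) (fderiv ℝ φ u w)
      + G' (φ u) (fderiv ℝ φ u b) (fderiv ℝ (fderiv ℝ φ) u a w) := by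
  have hDφ : HasFDerivAt (fderiv ℝ φ) (fderiv ℝ (fderiv ℝ φ) u) u :=
    ((hφ.fderiv_right (m := 1) (by norm_num)).differentiableAt (by norm_num)).hasFDerivAt
  have hφ1 : HasFDerivAt φ (fderiv ℝ φ u) u := (hφ.differentiableAt (by norm_num)).hasFDerivAt
  have h1 : HasFDerivAt (fun z ↦ G z b w) _ u :=
    (hG.hasFDerivAt.clm_apply (hasFDerivAt_const b u)).clm_apply (hasFDerivAt_const w u)
  have h2 : HasFDerivAt (fun z ↦ G' (φ z) (fderiv ℝ φ z b) (fderiv ℝ φ z w)) _ u :=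
    ((hG'.hasFDerivAt.comp u hφ1).clm_apply (hDφ.clm_apply (hasFDerivAt_const b u))).clm_apply
      (hDφ.clm_apply (hasFDerivAt_const w u))
  have h3 := h2.congr_of_eventuallyEq (f₁ := fun z ↦ G z b w) (hpull.mono fun z hz ↦ hz b w)
  have h4 := congrArg (fun l : E →L[ℝ] ℝ ↦ l a) (h1.unique h3)
  simp at h4
  rw [h4]
  ring

/-- The transformation law of the Levi-Civita expression under a change of coordinates. -/
theorem leviCivita_pullback {F : Type*} [NormedAddCommGroup F] [NormedSpace ℝ F]
    {G : E → E →L[ℝ] E →L[ℝ] ℝ} {G' : F → F →L[ℝ] F →L[ℝ] ℝ} {φ : E → F} {u : E}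
    (hφ : ContDiffAt ℝ 2 φ u) (hG : DifferentiableAt ℝ G u) (hG' : DifferentiableAt ℝ G' (φ u))
    (hpull : ∀ᶠ z in 𝓝 u, ∀ a b, G z a b = G' (φ z) (fderiv ℝ φ z a) (fderiv ℝ φ z b))
    (hsymm : ∀ a b, G' (φ u) a b = G' (φ u) b a) (a b w : E) :
    leviCivita (fderiv ℝ G u) a b w =
      leviCivita (fderiv ℝ G' (φ u)) (fderiv ℝ φ u a) (fderiv ℝ φ u b) (fderiv ℝ φ u w)
      + G' (φ u) (fderiv ℝ (fderiv ℝ φ) u a b) (fderiv ℝ φ u w) := by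
  have hs : ∀ v w, fderiv ℝ (fderiv ℝ φ) u v w = fderiv ℝ (fderiv ℝ φ) u w v :=
    fun v w ↦ (hφ.isSymmSndFDerivAt (by simp)) v w
  simp only [leviCivita, fderiv_pullback_form hφ hG hG' hpull]
  -- Of the six terms containing a second derivative of `φ`, four cancel by symmetry and the other
  -- two coincide.
  rw [hs b a, hs w a, hs w b, hsymm (fderiv ℝ φ u b) (fderiv ℝ (fderiv ℝ φ) u a w)]
  ring

/-- The Levi-Civita expression as a bilinear form in the last two arguments. -/
noncomputable def leviCivitaForm (D : E →L[ℝ] E →L[ℝ] E →L[ℝ] ℝ) (a : E) : E →L[ℝ] E →L[ℝ] ℝ :=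
  (1 / 2 : ℝ) • (D a + D.flip a - (D.flip a).flip)

theorem leviCivitaForm_apply (D : E →L[ℝ] E →L[ℝ] E →L[ℝ] ℝ) (a b w : E) :
    leviCivitaForm D a b w = leviCivita D a b w := by
  simp [leviCivitaForm, leviCivita]
  ring

/-- The equation of a parallel field with components `y` along a curve that passes at time `t`
through `u` with velocity `a`, for the metric `G`. -/
def CoordParallelAt (G : E → E →L[ℝ] E →L[ℝ] ℝ) (u a : E) (y : ℝ → E) (t : ℝ) : Prop :=
  ∃ y' : E, HasDerivAt y y' t ∧ ∀ w : E, G u y' w + leviCivita (fderiv ℝ G u) a (y t) w = 0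

section CoordParallelAt

variable {G : E → E →L[ℝ] E →L[ℝ] ℝ} {u : E} {a : E} {y z : ℝ → E} {t : ℝ}

theorem CoordParallelAt.congr (h : CoordParallelAt G u a y t) (hzy : ∀ᶠ s in 𝓝 t, z s = y s) :
    CoordParallelAt G u a z t := by
  obtain ⟨y', hy', heq⟩ := h
  refine ⟨y', hy'.congr_of_eventuallyEq hzy, ?_⟩
  rwa [hzy.self_of_nhds]

theorem CoordParallelAt.add (hy : CoordParallelAt G u a y t) (hz : CoordParallelAt G u a z t) :
    CoordParallelAt G u a (fun s ↦ y s + z s) t := by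
  obtain ⟨y', hy', hye⟩ := hy
  obtain ⟨z', hz', hze⟩ := hz
  refine ⟨y' + z', hy'.add hz', fun w ↦ ?_⟩
  have h1 := hye w
  have h2 := hze w
  simp only [leviCivita, map_add, add_apply] at h1 h2 ⊢
  linarith

theorem CoordParallelAt.const_smul (r : ℝ) (hy : CoordParallelAt G u a y t) :
    CoordParallelAt G u a (fun s ↦ r • y s) t := by
  obtain ⟨y', hy', hye⟩ := hy
  refine ⟨r • y', hy'.const_smul r, fun w ↦ ?_⟩
  have h1 := hye w
  simp only [leviCivita, map_smul, smul_apply, smul_eq_mul] at h1 ⊢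
  linear_combination r * h1

/-- Rescaling of time. -/
theorem CoordParallelAt.comp_mul_left (r : ℝ) (hy : CoordParallelAt G u a y (r * t)) :
    CoordParallelAt G u (r • a) (fun s ↦ y (r * s)) t := by
  obtain ⟨y', hy', hye⟩ := hy
  refine ⟨r • y', hy'.scomp t (by simpa using (hasDerivAt_id t).const_mul r), fun w ↦ ?_⟩
  have h1 := hye w
  simp only [leviCivita, map_smul, smul_apply, smul_eq_mul] at h1 ⊢
  linear_combination r * h1

theorem fderiv_form_symm (hG : DifferentiableAt ℝ G u) (hsymm : ∀ z a b, G z a b = G z b a)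
    (a b w : E) : fderiv ℝ G u a b w = fderiv ℝ G u a w b := by
  have h : ∀ b w : E, HasFDerivAt (fun z ↦ G z b w) _ u := fun b w ↦
    (hG.hasFDerivAt.clm_apply (hasFDerivAt_const b _)).clm_apply (hasFDerivAt_const w _)
  have h1 := h b w
  simp_rw [hsymm _ b w] at h1
  have := congrArg (fun l : E →L[ℝ] ℝ ↦ l a) (h1.unique (h w b))
  simpa using this

/-- The inner product of two parallel fields is constant. -/
theorem CoordParallelAt.hasDerivAt_form {c : ℝ → E} (hc : HasDerivAt c a t)
    (hG : DifferentiableAt ℝ G (c t)) (hsymm : ∀ z a b, G z a b = G z b a)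
    (hy : CoordParallelAt G (c t) a y t) (hz : CoordParallelAt G (c t) a z t) :
    HasDerivAt (fun s ↦ G (c s) (y s) (z s)) 0 t := by
  obtain ⟨y', hy', hye⟩ := hy
  obtain ⟨z', hz', hze⟩ := hz
  have h0 : HasDerivAt (fun s ↦ G (c s)) (fderiv ℝ G (c t) a) t :=
    hG.hasFDerivAt.comp_hasDerivAt t hc
  refine ((h0.clm_apply hy').clm_apply hz').congr_deriv ?_
  have h1 := hye (z t)
  have h2 := hze (y t)
  have h3 := leviCivita_add_swap (fderiv_form_symm hG hsymm) a (y t) (z t)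
  have h4 := hsymm (c t) z' (y t)
  simp only [add_apply]
  linarith

/-- Being parallel does not depend on the coordinates. -/
theorem CoordParallelAt.change_coordinates {G' : E → E →L[ℝ] E →L[ℝ] ℝ} {φ : E → E} {c : ℝ → E}
    (hc : HasDerivAt c a t) (hφ : ContDiffAt ℝ 2 φ (c t)) (hG : DifferentiableAt ℝ G (c t))
    (hG' : DifferentiableAt ℝ G' (φ (c t)))
    (hpull : ∀ᶠ z in 𝓝 (c t), ∀ a b, G z a b = G' (φ z) (fderiv ℝ φ z a) (fderiv ℝ φ z b))
    (hsymm : ∀ a b, G' (φ (c t)) a b = G' (φ (c t)) b a)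
    (hsurj : Function.Surjective (fderiv ℝ φ (c t)))
    (hz : ∀ᶠ s in 𝓝 t, z s = fderiv ℝ φ (c s) (y s))
    (hy : CoordParallelAt G (c t) a y t) :
    CoordParallelAt G' (φ (c t)) (fderiv ℝ φ (c t) a) z t := by
  obtain ⟨y', hy', hye⟩ := hy
  have hDφ : HasFDerivAt (fderiv ℝ φ) (fderiv ℝ (fderiv ℝ φ) (c t)) (c t) :=
    ((hφ.fderiv_right (m := 1) (by norm_num)).differentiableAt (by norm_num)).hasFDerivAt
  have hder : HasDerivAt (fun s ↦ fderiv ℝ φ (c s) (y s))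
      (fderiv ℝ (fderiv ℝ φ) (c t) a (y t) + fderiv ℝ φ (c t) y') t :=
    (hDφ.comp_hasDerivAt t hc).clm_apply hy'
  refine ⟨_, hder.congr_of_eventuallyEq hz, fun w ↦ ?_⟩
  -- Test vectors may be taken in the image of the derivative of `φ`; on these the Hessian term of
  -- `hder` is the inhomogeneous term of `leviCivita_pullback`.
  obtain ⟨w, rfl⟩ := hsurj w
  have h0 := hye w
  rw [leviCivita_pullback hφ hG hG' hpull hsymm a (y t) w, hpull.self_of_nhds y' w] at h0
  rw [hz.self_of_nhds, map_add, add_apply]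
  linarith

/-- Parallel fields exist locally, on an interval that does not depend on the initial data. -/
theorem exists_coordParallelAt [FiniteDimensional ℝ E] {U : Set E} (hU : IsOpen U)
    (hG : ContDiffOn ℝ ∞ G U) (hinj : ∀ u ∈ U, Function.Injective (G u)) {c : ℝ → E} {t₀ δ : ℝ}
    (hδ : 0 < δ) (hc : ContDiffOn ℝ ∞ c (Set.Ioo (t₀ - δ) (t₀ + δ)))
    (hmaps : Set.MapsTo c (Set.Ioo (t₀ - δ) (t₀ + δ)) U) :
    ∃ ε > 0, ε ≤ δ ∧ ∀ s ∈ Set.Ioo (t₀ - ε) (t₀ + ε), ∀ v : E, ∃ y : ℝ → E, y s = v ∧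
      ∀ t ∈ Set.Ioo (t₀ - ε) (t₀ + ε), CoordParallelAt G (c t) (deriv c t) y t := by
  set I := Set.Ioo (t₀ - δ) (t₀ + δ)
  have hc' : ContinuousOn (deriv c) I := hc.continuousOn_deriv_of_isOpen isOpen_Ioo (by simp)
  have hD : ContinuousOn (fun t ↦ fderiv ℝ G (c t)) I :=
    (hG.continuousOn_fderiv_of_isOpen hU (by simp)).comp hc.continuousOn hmaps
  -- With Λ the Levi-Civita form, the equation reads G y' = -Λ y. Nondegeneracy in finite dimension
  -- makes G invertible, leaving a linear ODE with continuous coefficients.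
  set Λ : ℝ → E →L[ℝ] E →L[ℝ] ℝ := fun t ↦
    leviCivitaForm (fderiv ℝ G (c t)) (deriv c t) with hΛ
  have hΛC : ContinuousOn Λ I := by
    rw [continuousOn_clm_apply]
    intro b
    rw [continuousOn_clm_apply]
    intro w
    simp only [hΛ, leviCivitaForm_apply, leviCivita]
    have hb : ContinuousOn (fun _ : ℝ ↦ b) I := continuousOn_const
    have hw : ContinuousOn (fun _ : ℝ ↦ w) I := continuousOn_const
    exact ((((hD.clm_apply hc').clm_apply hb).clm_apply hw).add
      (((hD.clm_apply hb).clm_apply hc').clm_apply hw) |>.sub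
      (((hD.clm_apply hw).clm_apply hc').clm_apply hb)).div_const 2
  have hfin : Module.finrank ℝ E = Module.finrank ℝ (E →L[ℝ] ℝ) := by
    rw [← (LinearMap.toContinuousLinearMap (𝕜 := ℝ) (E := E) (F' := ℝ)).finrank_eq]
    exact (Subspace.dual_finrank_eq (K := ℝ) (V := E)).symm
  have hinvertible : ∀ u ∈ U, (G u).IsInvertible := fun u hu ↦
    ⟨(LinearEquiv.ofInjectiveOfFinrankEq (G u).toLinearMap (hinj u hu)
      hfin).toContinuousLinearEquiv, by ext a b; rfl⟩
  have hinv : ContinuousOn (fun t ↦ (G (c t)).inverse) I := fun t ht ↦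
    ContinuousAt.comp_continuousWithinAt (f := fun t ↦ G (c t))
      ((hinvertible _ (hmaps ht)).contDiffAt_map_inverse (n := 0)).continuousAt
      ((hG.continuousOn.comp hc.continuousOn hmaps) t ht)
  have : CompleteSpace E := FiniteDimensional.complete ℝ E
  obtain ⟨ε, hε, hεδ, hsol⟩ := exists_linear_ode_solution
    (A := fun t ↦ -((G (c t)).inverse ∘L Λ t)) hδ (hinv.clm_comp hΛC).neg
  refine ⟨ε, hε, hεδ, fun s hs v ↦ ?_⟩
  obtain ⟨y, hys, hy⟩ := hsol s hs v
  refine ⟨y, hys, fun t ht ↦ ⟨_, hy t ht, fun w ↦ ?_⟩⟩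
  have htI : t ∈ I := ⟨by linarith [ht.1], by linarith [ht.2]⟩
  have h1 : G (c t) ((G (c t)).inverse (Λ t (y t))) = Λ t (y t) :=
    DFunLike.congr_fun (hinvertible _ (hmaps htI)).self_comp_inverse _
  rw [← leviCivitaForm_apply]
  simp only [neg_apply, ContinuousLinearMap.comp_apply, map_neg, h1]
  exact neg_add_cancel _

end CoordParallelAt

end Analysis

/-! ### Components of tangent vectors and of the metric in charts. -/

section Charts

variable {E : Type*} [NormedAddCommGroup E] [NormedSpace ℝ E]
  {M : Type*} [TopologicalSpace M] [ChartedSpace E M] [IsManifold 𝓘(ℝ, E) ∞ M]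

theorem mdifferentiable_chart_infty (c : M) :
    (chartAt E c).MDifferentiable 𝓘(ℝ, E) 𝓘(ℝ, E) :=
  haveI : IsManifold 𝓘(ℝ, E) 1 M := .of_le (n := ∞) (by simp)
  mdifferentiable_chart c

/-- The tangent vector at `x` with components `a` in the chart `chartAt E c`. -/
noncomputable def ofComponents (c x : M) (a : E) : TangentSpace 𝓘(ℝ, E) x :=
  (mfderiv 𝓘(ℝ, E) 𝓘(ℝ, E) (chartAt E c).symm (chartAt E c x) : E →L[ℝ] E) a

theorem ofComponents_chartComponents {c x : M} (hx : x ∈ (chartAt E c).source)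
    (v : TangentSpace 𝓘(ℝ, E) x) : ofComponents c x (chartComponents c v) = v :=
  DFunLike.congr_fun ((mdifferentiable_chart_infty c).symm_comp_deriv hx) v

theorem chartComponents_ofComponents {c x : M} (hx : x ∈ (chartAt E c).source)
    (a : E) : chartComponents c (ofComponents c x a) = a := by
  have h := DFunLike.congr_fun ((mdifferentiable_chart_infty c).comp_symm_deriv
    ((chartAt E c).map_source hx)) a
  rw [(chartAt E c).left_inv hx] at h
  exact h

theorem chartComponents_add (c : M) {x : M} (v w : TangentSpace 𝓘(ℝ, E) x) :
    chartComponents c (v + w) = chartComponents c v + chartComponents c w :=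
  map_add (mfderiv 𝓘(ℝ, E) 𝓘(ℝ, E) (chartAt E c) x) v w

theorem chartComponents_smul (c : M) {x : M} (r : ℝ) (v : TangentSpace 𝓘(ℝ, E) x) :
    chartComponents c (r • v) = r • chartComponents c v :=
  map_smul (mfderiv 𝓘(ℝ, E) 𝓘(ℝ, E) (chartAt E c) x) r v

/-- The change of coordinates from the chart at `c` to the chart at `c'`. -/
noncomputable def transition (c c' : M) : E → E := chartAt E c' ∘ (chartAt E c).symm

theorem transition_apply_chart {c c' x : M} (hx : x ∈ (chartAt E c).source) :
    transition c c' (chartAt E c x) = chartAt E c' x := by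
  simp [transition, (chartAt E c).left_inv hx]

theorem contDiffAt_transition {c c' x : M} (hx : x ∈ (chartAt E c).source)
    (hx' : x ∈ (chartAt E c').source) :
    ContDiffAt ℝ ∞ (transition (E := E) c c') (chartAt E c x) := by
  rw [← contMDiffAt_iff_contDiffAt]
  have h1 : ContMDiffAt 𝓘(ℝ, E) 𝓘(ℝ, E) ∞ (chartAt E c).symm (chartAt E c x) :=
    (contMDiffOn_chart_symm (I := 𝓘(ℝ, E)) (x := c)).contMDiffAt
      ((chartAt E c).open_target.mem_nhds ((chartAt E c).map_source hx))
  refine ContMDiffAt.comp _ ?_ h1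
  rw [(chartAt E c).left_inv hx]
  exact (contMDiffOn_chart (I := 𝓘(ℝ, E)) (x := c')).contMDiffAt
      ((chartAt E c').open_source.mem_nhds hx')

theorem chartComponents_transition {c c' x : M} (hx : x ∈ (chartAt E c).source)
    (hx' : x ∈ (chartAt E c').source) (v : TangentSpace 𝓘(ℝ, E) x) :
    chartComponents c' v =
      fderiv ℝ (transition (E := E) c c') (chartAt E c x) (chartComponents c v) := by
  have hd : MDifferentiableAt 𝓘(ℝ, E) 𝓘(ℝ, E) (transition (E := E) c c') (chartAt E c x) :=
    ((contDiffAt_transition hx hx').differentiableAt (by simp)).mdifferentiableAt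
  have h := mfderiv_comp x hd ((mdifferentiable_chart_infty c).mdifferentiableAt hx)
  have he : transition (E := E) c c' ∘ chartAt E c =ᶠ[𝓝 x] chartAt E c' := by
    filter_upwards [(chartAt E c).open_source.mem_nhds hx] with z hz
    exact transition_apply_chart hz
  rw [mfderiv_eq_fderiv] at h
  have h2 := he.mfderiv_eq (I := 𝓘(ℝ, E)) (I' := 𝓘(ℝ, E))
  unfold chartComponents
  exact (DFunLike.congr_fun h2 v).symm.trans (DFunLike.congr_fun h v)

section Metric

variable [RiemannianBundle (fun x : M ↦ TangentSpace 𝓘(ℝ, E) x)]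

theorem chartMetric_eq_inner_ofComponents {c x : M} (hx : x ∈ (chartAt E c).source) (a b : E) :
    chartMetric c (chartAt E c x) a b = inner ℝ (ofComponents c x a) (ofComponents c x b) := by
  -- The base points `(chartAt E c).symm (chartAt E c x)` and `x` are only propositionally equal, so
  -- the tangent space is changed by induction on that equality.
  have key : ∀ q : M, q = x → ∀ A : E →L[ℝ] E,
      @inner ℝ (TangentSpace 𝓘(ℝ, E) q) _ (A a) (A b) =
        @inner ℝ (TangentSpace 𝓘(ℝ, E) x) _ (A a) (A b) := by
    rintro q rfl A; rfl
  exact key _ ((chartAt E c).left_inv hx)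
    (mfderiv 𝓘(ℝ, E) 𝓘(ℝ, E) (chartAt E c).symm (chartAt E c x))

theorem chartMetric_chartComponents {c x : M} (hx : x ∈ (chartAt E c).source)
    (v w : TangentSpace 𝓘(ℝ, E) x) :
    chartMetric c (chartAt E c x) (chartComponents c v) (chartComponents c w) = inner ℝ v w := by
  rw [chartMetric_eq_inner_ofComponents hx, ofComponents_chartComponents hx,
    ofComponents_chartComponents hx]

variable [FiniteDimensional ℝ E]

/-- The coordinate expression of the metric as a continuous bilinear form. -/
noncomputable def metricForm (c : M) (u : E) : E →L[ℝ] E →L[ℝ] ℝ :=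
  LinearMap.toContinuousLinearMap
    ((LinearMap.toContinuousLinearMap (𝕜 := ℝ) (E := E) (F' := ℝ)).toLinearMap ∘ₗ
      LinearMap.mk₂ ℝ (chartMetric c u)
        (fun a b _ ↦ (congrArg₂ (inner ℝ)
          (map_add (mfderiv 𝓘(ℝ, E) 𝓘(ℝ, E) (chartAt E c).symm u) a b) rfl).trans
          (inner_add_left _ _ _))
        (fun r a _ ↦ (congrArg₂ (inner ℝ)
          (map_smul (mfderiv 𝓘(ℝ, E) 𝓘(ℝ, E) (chartAt E c).symm u) r a) rfl).trans
          (real_inner_smul_left _ _ _))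
        (fun _ b w ↦ (congrArg₂ (inner ℝ) rfl
          (map_add (mfderiv 𝓘(ℝ, E) 𝓘(ℝ, E) (chartAt E c).symm u) b w)).trans
          (inner_add_right _ _ _))
        (fun r _ w ↦ (congrArg₂ (inner ℝ) rfl
          (map_smul (mfderiv 𝓘(ℝ, E) 𝓘(ℝ, E) (chartAt E c).symm u) r w)).trans
          (real_inner_smul_right _ _ _)))

theorem metricForm_apply (c : M) (u a b : E) : metricForm c u a b = chartMetric c u a b := rfl

theorem metricForm_symm (c : M) (u a b : E) : metricForm c u a b = metricForm c u b a := by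
  simp only [metricForm_apply, chartMetric, real_inner_comm]

theorem metricForm_chartComponents {c x : M} (hx : x ∈ (chartAt E c).source)
    (v w : TangentSpace 𝓘(ℝ, E) x) :
    metricForm c (chartAt E c x) (chartComponents c v) (chartComponents c w) = inner ℝ v w :=
  chartMetric_chartComponents hx v w

/-- Both sides are the inner product of the same two tangent vectors at `x`. -/
theorem metricForm_transition {c c' x : M} (hx : x ∈ (chartAt E c).source)
    (hx' : x ∈ (chartAt E c').source) (a b : E) :
    metricForm c (chartAt E c x) a b = metricForm c' (chartAt E c' x)
      (fderiv ℝ (transition (E := E) c c') (chartAt E c x) a)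
      (fderiv ℝ (transition (E := E) c c') (chartAt E c x) b) := by
  obtain ⟨v, rfl⟩ : ∃ v : TangentSpace 𝓘(ℝ, E) x, chartComponents c v = a :=
    ⟨_, chartComponents_ofComponents hx a⟩
  obtain ⟨w, rfl⟩ : ∃ w : TangentSpace 𝓘(ℝ, E) x, chartComponents c w = b :=
    ⟨_, chartComponents_ofComponents hx b⟩
  rw [← chartComponents_transition hx hx', ← chartComponents_transition hx hx',
    metricForm_chartComponents hx, metricForm_chartComponents hx']

theorem eq_zero_of_metricForm_eq_zero {c x : M} (hx : x ∈ (chartAt E c).source) {a : E}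
    (h : ∀ w, metricForm c (chartAt E c x) a w = 0) : a = 0 := by
  have h1 := h a
  rw [metricForm_apply, chartMetric_eq_inner_ofComponents hx, inner_self_eq_zero] at h1
  rw [← chartComponents_ofComponents hx a, h1]
  exact map_zero (mfderiv 𝓘(ℝ, E) 𝓘(ℝ, E) (chartAt E c) x)

theorem injective_metricForm {c : M} {u : E} (hu : u ∈ (chartAt E c).target) :
    Function.Injective (metricForm c u) := by
  refine (injective_iff_map_eq_zero _).2 fun a ha ↦ ?_
  rw [← (chartAt E c).right_inv hu] at ha
  exact eq_zero_of_metricForm_eq_zero ((chartAt E c).map_target hu) fun w ↦ by rw [ha]; rfl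

variable [IsContMDiffRiemannianBundle 𝓘(ℝ, E) ∞ E (fun x : M ↦ TangentSpace 𝓘(ℝ, E) x)]

/-- The coordinate vector fields are smooth, as images of constant sections under the tangent map of
the inverse chart, and the bundle metric is smooth on smooth sections. -/
theorem contDiffOn_metricForm (c : M) : ContDiffOn ℝ ∞ (metricForm (E := E) c) (chartAt E c).target := by
  rw [contDiffOn_clm_apply]
  intro a
  rw [contDiffOn_clm_apply]
  intro b
  have hs : ∀ a : E, ContMDiffOn 𝓘(ℝ, E) (𝓘(ℝ, E).prod 𝓘(ℝ, E)) ∞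
      (fun u ↦ (⟨(chartAt E c).symm u, mfderiv 𝓘(ℝ, E) 𝓘(ℝ, E) (chartAt E c).symm u a⟩ :
        TotalSpace E (fun x : M ↦ TangentSpace 𝓘(ℝ, E) x))) (chartAt E c).target := by
    intro a
    have h1 := (contMDiffOn_chart_symm (I := 𝓘(ℝ, E)) (n := ∞) (x := c)).contMDiffOn_tangentMapWithin
      (m := ∞) (by simp) (chartAt E c).open_target.uniqueMDiffOn
    have h2 : ContMDiff 𝓘(ℝ, E) (𝓘(ℝ, E).prod 𝓘(ℝ, E)) ∞
      (fun u ↦ (⟨u, a⟩ : TangentBundle 𝓘(ℝ, E) E)) := by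
      exact contMDiff_vectorSpace_iff_contDiff.2 contDiff_const
    refine (h1.comp h2.contMDiffOn (fun u hu ↦ hu)).congr fun u hu ↦ ?_
    simp [tangentMapWithin, mfderivWithin_of_isOpen (chartAt E c).open_target hu]
  exact contMDiffOn_iff_contDiffOn.1 (ContMDiffOn.inner_bundle
    (E := fun x : M ↦ TangentSpace 𝓘(ℝ, E) x)
    (v := fun u ↦ mfderiv 𝓘(ℝ, E) 𝓘(ℝ, E) (chartAt E c).symm u a)
    (w := fun u ↦ mfderiv 𝓘(ℝ, E) 𝓘(ℝ, E) (chartAt E c).symm u b) (hs a) (hs b))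

theorem christoffel_eq_leviCivita {c : M} {u : E} (hG : DifferentiableAt ℝ (metricForm (E := E) c) u)
    (a b w : E) : christoffel c u a b w = leviCivita (fderiv ℝ (metricForm c) u) a b w := by
  have key : ∀ a b w : E, fderiv ℝ (fun u' ↦ chartMetric c u' b w) u a
      = fderiv ℝ (metricForm c) u a b w := fun a b w ↦ by
    have h1 : HasFDerivAt (fun z ↦ metricForm c z b w) _ u :=
      (hG.hasFDerivAt.clm_apply (hasFDerivAt_const b u)).clm_apply (hasFDerivAt_const w u)
    have := congrArg (fun l : E →L[ℝ] ℝ ↦ l a) h1.fderiv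
    simpa [metricForm_apply] using this
  simp only [christoffel, leviCivita, key]

end Metric

end Charts

/-! ### Parallel fields along curves: existence, uniqueness, constancy of inner products. -/

section Parallel

variable {E : Type*} [NormedAddCommGroup E] [NormedSpace ℝ E] [FiniteDimensional ℝ E]
  {M : Type*} [TopologicalSpace M] [ChartedSpace E M] [IsManifold 𝓘(ℝ, E) ∞ M]
  [RiemannianBundle (fun x : M ↦ TangentSpace 𝓘(ℝ, E) x)]
  [IsContMDiffRiemannianBundle 𝓘(ℝ, E) ∞ E (fun x : M ↦ TangentSpace 𝓘(ℝ, E) x)]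

theorem differentiableAt_metricForm {c x : M} (hx : x ∈ (chartAt E c).source) :
    DifferentiableAt ℝ (metricForm (E := E) c) (chartAt E c x) :=
  ((contDiffOn_metricForm c).contDiffAt ((chartAt E c).open_target.mem_nhds
    ((chartAt E c).map_source hx))).differentiableAt (by simp)

/-- The equation of a parallel field at time `t`, in the chart `chartAt E c`. -/
def IsParallelInChart (c : M) (γ : ℝ → M) (V : ∀ t, TangentSpace 𝓘(ℝ, E) (γ t)) (t : ℝ) : Prop :=
  CoordParallelAt (metricForm c) (chartAt E c (γ t)) (chartComponents c (velocity E γ t))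
    (fun s ↦ chartComponents c (V s)) t

/-- The field `V` along `γ` satisfies the equation of a parallel field at time `t`, in all
charts. -/
def IsParallelAt (γ : ℝ → M) (V : ∀ t, TangentSpace 𝓘(ℝ, E) (γ t)) (t : ℝ) : Prop :=
  ∀ c : M, γ t ∈ (chartAt E c).source → IsParallelInChart c γ V t

/-- The pointwise form is needed because fields are first built on bounded intervals. -/
theorem isParallelAlong_iff {γ : ℝ → M} {V : ∀ t, TangentSpace 𝓘(ℝ, E) (γ t)} :
    IsParallelAlong γ V ↔ ∀ t, IsParallelAt γ V t := by
  refine forall_congr' fun t ↦ forall_congr' fun c ↦ forall_congr' fun hc ↦ ?_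
  refine exists_congr fun V' ↦ and_congr_right fun _ ↦ forall_congr' fun w ↦ ?_
  rw [christoffel_eq_leviCivita (differentiableAt_metricForm hc), metricForm_apply]

theorem hasDerivAt_chart_comp {γ : ℝ → M} {t : ℝ} (hγ : MDifferentiableAt 𝓘(ℝ, ℝ) 𝓘(ℝ, E) γ t)
    {c : M} (hc : γ t ∈ (chartAt E c).source) :
    HasDerivAt (fun s ↦ chartAt E c (γ s)) (chartComponents c (velocity E γ t)) t := by
  have h := ((mdifferentiable_chart_infty c).mdifferentiableAt hc).hasMFDerivAt.comp t
    hγ.hasMFDerivAt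
  obtain ⟨l, hl, h'⟩ : ∃ l : ℝ →L[ℝ] E, l 1 = chartComponents c (velocity E γ t) ∧
      HasFDerivAt (fun s ↦ chartAt E c (γ s)) l t := ⟨_, rfl, hasMFDerivAt_iff_hasFDerivAt.1 h⟩
  exact hl ▸ h'.hasDerivAt

variable {γ : ℝ → M} {V W : ∀ t, TangentSpace 𝓘(ℝ, E) (γ t)} {t : ℝ}

/-- Parallelism quantifies over all charts, while ODE solutions are built in one; applying
`CoordParallelAt.change_coordinates` to the transition map bridges the gap. -/
theorem IsParallelInChart.change_chart (hγ : MDifferentiableAt 𝓘(ℝ, ℝ) 𝓘(ℝ, E) γ t) {c c' : M}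
    (hc : γ t ∈ (chartAt E c).source) (hc' : γ t ∈ (chartAt E c').source)
    (h : IsParallelInChart c γ V t) : IsParallelInChart c' γ V t := by
  have hφu : transition (E := E) c c' (chartAt E c (γ t)) = chartAt E c' (γ t) :=
    transition_apply_chart hc
  have hcont : ContinuousAt γ t := hγ.continuousAt
  have hev : ∀ᶠ s in 𝓝 t, chartComponents c' (V s) =
      fderiv ℝ (transition (E := E) c c') (chartAt E c (γ s)) (chartComponents c (V s)) := by
    filter_upwards [hcont.eventually ((chartAt E c).open_source.mem_nhds hc),
      hcont.eventually ((chartAt E c').open_source.mem_nhds hc')] with s hs hs'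
    exact chartComponents_transition hs hs' _
  have hpull : ∀ᶠ z in 𝓝 (chartAt E c (γ t)), ∀ a b, metricForm c z a b =
      metricForm c' (transition (E := E) c c' z) (fderiv ℝ (transition (E := E) c c') z a)
        (fderiv ℝ (transition (E := E) c c') z b) := by
    have h1 : ContinuousAt (chartAt E c).symm (chartAt E c (γ t)) :=
      (chartAt E c).continuousAt_symm ((chartAt E c).map_source hc)
    have h2 : (chartAt E c).symm (chartAt E c (γ t)) = γ t := (chartAt E c).left_inv hc
    filter_upwards [(chartAt E c).open_target.mem_nhds ((chartAt E c).map_source hc),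
      h1.eventually ((chartAt E c').open_source.mem_nhds (h2.symm ▸ hc'))] with z hz hz' a b
    have := metricForm_transition ((chartAt E c).map_target hz) hz' a b
    rwa [(chartAt E c).right_inv hz] at this
  have hsurj : Function.Surjective (fderiv ℝ (transition (E := E) c c') (chartAt E c (γ t))) := by
    intro w
    refine ⟨chartComponents c (ofComponents c' (γ t) w), ?_⟩
    rw [← chartComponents_transition hc hc', chartComponents_ofComponents hc']
  have := CoordParallelAt.change_coordinates (hasDerivAt_chart_comp hγ hc)
    ((contDiffAt_transition hc hc').of_le (by norm_cast))
    (differentiableAt_metricForm hc) (G' := metricForm c')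
    (by rw [hφu]; exact differentiableAt_metricForm hc') hpull
    (metricForm_symm c' _) hsurj hev h
  rwa [hφu, ← chartComponents_transition hc hc'] at this

theorem IsParallelInChart.isParallelAt (hγ : MDifferentiableAt 𝓘(ℝ, ℝ) 𝓘(ℝ, E) γ t) {c : M}
    (hc : γ t ∈ (chartAt E c).source) (h : IsParallelInChart c γ V t) : IsParallelAt γ V t :=
  fun _ hc' ↦ h.change_chart hγ hc hc'

theorem IsParallelAt.congr (h : IsParallelAt γ V t)
    (hVW : ∀ᶠ s in 𝓝 t, W s = V s) : IsParallelAt γ W t := fun c hc ↦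
  CoordParallelAt.congr (h c hc) (hVW.mono fun s hs ↦ by simp only [hs])

theorem IsParallelAt.add (hV : IsParallelAt γ V t) (hW : IsParallelAt γ W t) :
    IsParallelAt γ (fun s ↦ V s + W s) t := fun c hc ↦ by
  simpa only [IsParallelInChart, chartComponents_add] using CoordParallelAt.add (hV c hc) (hW c hc)

theorem IsParallelAt.const_smul (r : ℝ) (hV : IsParallelAt γ V t) :
    IsParallelAt γ (fun s ↦ r • V s) t := fun c hc ↦ by
  simpa only [IsParallelInChart, chartComponents_smul] using
    CoordParallelAt.const_smul r (hV c hc)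

theorem IsParallelAt.sub (hV : IsParallelAt γ V t) (hW : IsParallelAt γ W t) :
    IsParallelAt γ (fun s ↦ V s - W s) t := by
  have := hV.add (hW.const_smul (-1))
  simpa only [neg_smul, one_smul, ← sub_eq_add_neg] using this

/-- The inner product of two parallel fields is constant. -/
theorem IsParallelAt.hasDerivAt_inner (hγ : MDifferentiableAt 𝓘(ℝ, ℝ) 𝓘(ℝ, E) γ t)
    (hV : IsParallelAt γ V t) (hW : IsParallelAt γ W t) :
    HasDerivAt (fun s ↦ inner ℝ (V s) (W s)) 0 t := by
  have hc : γ t ∈ (chartAt E (γ t)).source := mem_chart_source E (γ t)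
  have hder := CoordParallelAt.hasDerivAt_form (hasDerivAt_chart_comp hγ hc)
    (differentiableAt_metricForm hc) (metricForm_symm _) (hV _ hc) (hW _ hc)
  refine hder.congr_of_eventuallyEq ?_
  filter_upwards [hγ.continuousAt.eventually ((chartAt E (γ t)).open_source.mem_nhds hc)] with s hs
  exact (metricForm_chartComponents hs _ _).symm

theorem inner_eq_inner_of_isParallelAt (hγ : MDifferentiable 𝓘(ℝ, ℝ) 𝓘(ℝ, E) γ) {a b : ℝ}
    (hV : ∀ t ∈ Set.Ioo a b, IsParallelAt γ V t) (hW : ∀ t ∈ Set.Ioo a b, IsParallelAt γ W t)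
    {s : ℝ} (hs : s ∈ Set.Ioo a b) (ht : t ∈ Set.Ioo a b) :
    (inner ℝ (V t) (W t) : ℝ) = inner ℝ (V s) (W s) := by
  have hD : ∀ r ∈ Set.Ioo a b, HasDerivAt (fun s ↦ inner ℝ (V s) (W s)) 0 r := fun r hr ↦
    (hV r hr).hasDerivAt_inner (hγ r) (hW r hr)
  exact isOpen_Ioo.is_const_of_deriv_eq_zero isPreconnected_Ioo
    (fun r hr ↦ (hD r hr).differentiableAt.differentiableWithinAt)
    (fun r hr ↦ (hD r hr).deriv) ht hs

/-- Two fields which are parallel on an interval and agree at one time agree on the interval. -/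
theorem eq_of_isParallelAt (hγ : MDifferentiable 𝓘(ℝ, ℝ) 𝓘(ℝ, E) γ) {a b : ℝ}
    (hV : ∀ t ∈ Set.Ioo a b, IsParallelAt γ V t) (hW : ∀ t ∈ Set.Ioo a b, IsParallelAt γ W t)
    {s : ℝ} (hs : s ∈ Set.Ioo a b) (hVW : V s = W s) (ht : t ∈ Set.Ioo a b) : V t = W t := by
  have hD : ∀ r ∈ Set.Ioo a b, IsParallelAt γ (fun s ↦ V s - W s) r := fun r hr ↦
    (hV r hr).sub (hW r hr)
  have hconst := inner_eq_inner_of_isParallelAt hγ hD hD hs ht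
  simp only [hVW, sub_self, inner_zero_left, inner_self_eq_zero] at hconst
  exact sub_eq_zero.1 hconst

/-- Parallel fields exist locally, on an interval that does not depend on the initial data. -/
theorem exists_isParallelAt_near (hγ : ContMDiff 𝓘(ℝ, ℝ) 𝓘(ℝ, E) ∞ γ) (t₀ : ℝ) :
    ∃ ε > 0, ∀ s ∈ Set.Ioo (t₀ - ε) (t₀ + ε), ∀ v : TangentSpace 𝓘(ℝ, E) (γ s),
      ∃ V : ∀ t, TangentSpace 𝓘(ℝ, E) (γ t), V s = v ∧
        ∀ t ∈ Set.Ioo (t₀ - ε) (t₀ + ε), IsParallelAt γ V t := by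
  set c := γ t₀ with hcdef
  have hγd : MDifferentiable 𝓘(ℝ, ℝ) 𝓘(ℝ, E) γ := hγ.mdifferentiable (by simp)
  obtain ⟨δ, hδ, hsrc⟩ : ∃ δ > 0, ∀ t ∈ Set.Ioo (t₀ - δ) (t₀ + δ), γ t ∈ (chartAt E c).source := by
    have := hγ.continuous.continuousAt.preimage_mem_nhds
      ((chartAt E c).open_source.mem_nhds (mem_chart_source E (γ t₀)))
    obtain ⟨δ, hδ, h⟩ := Metric.mem_nhds_iff.1 this
    exact ⟨δ, hδ, fun t ht ↦ h (by rwa [Real.ball_eq_Ioo])⟩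
  have huC : ContDiffOn ℝ ∞ (fun s ↦ chartAt E c (γ s)) (Set.Ioo (t₀ - δ) (t₀ + δ)) := by
    rw [← contMDiffOn_iff_contDiffOn]
    exact (contMDiffOn_chart (I := 𝓘(ℝ, E)) (x := c)).comp hγ.contMDiffOn hsrc
  obtain ⟨ε, hε, hεδ, hsol⟩ := exists_coordParallelAt (chartAt E c).open_target
    (contDiffOn_metricForm c) (fun u hu ↦ injective_metricForm hu) hδ huC
    (fun t ht ↦ (chartAt E c).map_source (hsrc t ht))
  have hIsub : ∀ t ∈ Set.Ioo (t₀ - ε) (t₀ + ε), t ∈ Set.Ioo (t₀ - δ) (t₀ + δ) := fun t ht ↦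
    ⟨by linarith [ht.1], by linarith [ht.2]⟩
  refine ⟨ε, hε, fun s hs v ↦ ?_⟩
  obtain ⟨y, hys, hy⟩ := hsol s hs (chartComponents c v)
  refine ⟨fun t ↦ ofComponents c (γ t) (y t), ?_, fun t ht ↦ ?_⟩
  · simp only [hys]
    exact ofComponents_chartComponents (hsrc s (hIsub s hs)) v
  · have hct := hsrc t (hIsub t ht)
    have h1 := hy t ht
    rw [(hasDerivAt_chart_comp (hγd t) hct).deriv] at h1
    refine IsParallelInChart.isParallelAt (hγd t) hct (CoordParallelAt.congr h1 ?_)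
    filter_upwards [Ioo_mem_nhds ht.1 ht.2] with r hr
    exact chartComponents_ofComponents (hsrc r (hIsub r hr)) _

/-- Parallel transport exists along every smooth curve. -/
theorem exists_isParallelAlong (hγ : ContMDiff 𝓘(ℝ, ℝ) 𝓘(ℝ, E) ∞ γ) (o : ℝ)
    (v : TangentSpace 𝓘(ℝ, E) (γ o)) :
    ∃ V : ∀ t, TangentSpace 𝓘(ℝ, E) (γ t), V o = v ∧ IsParallelAlong γ V := by
  simp only [isParallelAlong_iff]
  have hγd : MDifferentiable 𝓘(ℝ, ℝ) 𝓘(ℝ, E) γ := hγ.mdifferentiable (by simp)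
  -- Half-lengths T of intervals around `o` that carry a solution. At a finite supremum, local
  -- fields near both endpoints would extend the solution past it.
  let Good : Set ℝ := {T | 0 < T ∧ ∃ V : ∀ t, TangentSpace 𝓘(ℝ, E) (γ t), V o = v ∧
    ∀ t ∈ Set.Ioo (o - T) (o + T), IsParallelAt γ V t}
  have hne : Good.Nonempty := by
    obtain ⟨ε, hε, h⟩ := exists_isParallelAt_near hγ o
    obtain ⟨V, hV0, hV⟩ := h o ⟨by linarith, by linarith⟩ v
    exact ⟨ε, hε, V, hV0, hV⟩
  have hunb : ¬ BddAbove Good := by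
    intro hb
    set T := sSup Good with hT
    obtain ⟨T₀, hT₀⟩ := hne
    have hTpos : 0 < T := hT₀.1.trans_le (le_csSup hb hT₀)
    obtain ⟨ε₁, hε₁, h₁⟩ := exists_isParallelAt_near hγ (o + T)
    obtain ⟨ε₂, hε₂, h₂⟩ := exists_isParallelAt_near hγ (o - T)
    set ε := min T (min ε₁ ε₂) with hεdef
    have hε : 0 < ε := lt_min hTpos (lt_min hε₁ hε₂)
    have hεT : ε ≤ T := min_le_left _ _
    have hεε₁ : ε ≤ ε₁ := (min_le_right _ _).trans (min_le_left _ _)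
    have hεε₂ : ε ≤ ε₂ := (min_le_right _ _).trans (min_le_right _ _)
    obtain ⟨T', ⟨hT'pos, V, hV0, hV⟩, hT'⟩ := exists_lt_of_lt_csSup ⟨T₀, hT₀⟩
      (show T - ε < sSup Good by linarith)
    have hT'T : T' ≤ T := le_csSup hb ⟨hT'pos, V, hV0, hV⟩
    -- The times `o ± s` lie in the interval of `V` and in those around `o ± T`. The local fields
    -- start there from the values of `V`, so they agree with `V` on the overlaps and can replace it
    -- beyond.
    set s := (T - ε + T') / 2 with hs
    have hs1 : T - ε < s := by linarith
    have hs2 : s < T' := by linarith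
    obtain ⟨V₁, hV₁s, hV₁⟩ := h₁ (o + s) ⟨by linarith, by linarith⟩ (V (o + s))
    obtain ⟨V₂, hV₂s, hV₂⟩ := h₂ (o - s) ⟨by linarith, by linarith⟩ (V (o - s))
    have hagree₁ : ∀ t ∈ Set.Ioo (o + (T - ε)) (o + T'), V t = V₁ t := fun t ht ↦
      eq_of_isParallelAt hγd (fun r hr ↦ hV r ⟨by linarith [hr.1], hr.2⟩)
        (fun r hr ↦ hV₁ r ⟨by linarith [hr.1], by linarith [hr.2]⟩)
        (s := o + s) ⟨by linarith, by linarith⟩ hV₁s.symm ht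
    have hagree₂ : ∀ t ∈ Set.Ioo (o - T') (o - (T - ε)), V t = V₂ t := fun t ht ↦
      eq_of_isParallelAt hγd (fun r hr ↦ hV r ⟨hr.1, by linarith [hr.2]⟩)
        (fun r hr ↦ hV₂ r ⟨by linarith [hr.1], by linarith [hr.2]⟩)
        (s := o - s) ⟨by linarith, by linarith⟩ hV₂s.symm ht
    let W : ∀ t, TangentSpace 𝓘(ℝ, E) (γ t) := fun t ↦
      if o + s < t then V₁ t else if t < o - s then V₂ t else V t
    have hWV : ∀ t ∈ Set.Ioo (o - T') (o + T'), W t = V t := by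
      intro t ht
      simp only [W]
      split_ifs with h1 h2
      · exact (hagree₁ t ⟨by linarith, ht.2⟩).symm
      · exact (hagree₂ t ⟨ht.1, by linarith⟩).symm
      · rfl
    have hgood : T + ε ∈ Good := by
      refine ⟨by linarith, W, (hWV o ⟨by linarith, by linarith⟩).trans hV0, fun t ht ↦ ?_⟩
      by_cases h1 : o + s < t
      · refine (hV₁ t ⟨by linarith, by linarith [ht.2]⟩).congr ?_
        filter_upwards [Ioi_mem_nhds h1] with r hr
        simp only [W, if_pos (Set.mem_Ioi.1 hr)]
      by_cases h2 : t < o - s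
      · refine (hV₂ t ⟨by linarith [ht.1], by linarith [ht.2]⟩).congr ?_
        filter_upwards [Iio_mem_nhds h2] with r hr
        have hr' : r < o - s := hr
        simp only [W, if_pos hr', if_neg (show ¬ o + s < r by linarith)]
      · have htT : t ∈ Set.Ioo (o - T') (o + T') := ⟨by linarith, by linarith⟩
        refine (hV t htT).congr ?_
        filter_upwards [Ioo_mem_nhds htT.1 htT.2] with r hr using hWV r hr
    have := le_csSup hb hgood
    linarith
  have hall : ∀ n : ℕ, ∃ V : ∀ t, TangentSpace 𝓘(ℝ, E) (γ t), V o = v ∧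
      ∀ t ∈ Set.Ioo (o - ((n : ℝ) + 1)) (o + (n + 1)), IsParallelAt γ V t := by
    intro n
    obtain ⟨T, ⟨_, V, hV0, hV⟩, hT⟩ := not_bddAbove_iff.1 hunb ((n : ℝ) + 1)
    exact ⟨V, hV0, fun t ht ↦ hV t ⟨by linarith [ht.1], by linarith [ht.2]⟩⟩
  choose V hV0 hV using hall
  have hagree : ∀ m n : ℕ, m ≤ n → ∀ t ∈ Set.Ioo (o - ((m : ℝ) + 1)) (o + (m + 1)),
      V n t = V m t := by
    intro m n hmn t ht
    have hmn' : (m : ℝ) ≤ n := by exact_mod_cast hmn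
    exact eq_of_isParallelAt hγd
      (fun r hr ↦ hV n r ⟨by linarith [hr.1], by linarith [hr.2]⟩) (hV m)
      (s := o) ⟨by linarith [ht.1, ht.2], by linarith [ht.1, ht.2]⟩
      ((hV0 n).trans (hV0 m).symm) ht
  -- The extra 1 in the half-lengths keeps `t` inside the chosen open interval when |t - o| is an
  -- integer.
  refine ⟨fun t ↦ V ⌈|t - o|⌉₊ t, by simp [hV0], fun t ↦ ?_⟩
  obtain ⟨N, hN⟩ := exists_nat_gt |t - o|
  have hN' := abs_lt.1 hN
  refine (hV N t ⟨by linarith [hN'.1], by linarith [hN'.2]⟩).congr ?_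
  filter_upwards [Ioo_mem_nhds (a := o - N) (b := o + N) (by linarith) (by linarith)] with r hr
  have hr' : |r - o| ≤ ⌈|r - o|⌉₊ := Nat.le_ceil _
  have h1 : ⌈|r - o|⌉₊ ≤ N :=
    Nat.ceil_le.2 (abs_le.2 ⟨by linarith [hr.1], by linarith [hr.2]⟩)
  exact (hagree _ N h1 r
    ⟨by linarith [neg_abs_le (r - o)], by linarith [le_abs_self (r - o)]⟩).symm

theorem IsParallelAlong.inner_eq (hγ : ContMDiff 𝓘(ℝ, ℝ) 𝓘(ℝ, E) ∞ γ)
    (hV : IsParallelAlong γ V) (hW : IsParallelAlong γ W) (s t : ℝ) :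
    (inner ℝ (V t) (W t) : ℝ) = inner ℝ (V s) (W s) := by
  rw [isParallelAlong_iff] at hV hW
  exact inner_eq_inner_of_isParallelAt (a := min s t - 1) (b := max s t + 1)
    (hγ.mdifferentiable (by simp)) (fun t _ ↦ hV t) (fun t _ ↦ hW t)
    ⟨by linarith [min_le_left s t], by linarith [le_max_left s t]⟩
    ⟨by linarith [min_le_right s t], by linarith [le_max_right s t]⟩

theorem IsParallelAlong.sub (hV : IsParallelAlong γ V) (hW : IsParallelAlong γ W) :
    IsParallelAlong γ (fun s ↦ V s - W s) := by
  rw [isParallelAlong_iff] at *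
  exact fun t ↦ (hV t).sub (hW t)

theorem IsParallelAlong.norm_eq (hγ : ContMDiff 𝓘(ℝ, ℝ) 𝓘(ℝ, E) ∞ γ)
    (hV : IsParallelAlong γ V) (s t : ℝ) : ‖V t‖ = ‖V s‖ := by
  rw [norm_eq_sqrt_real_inner, norm_eq_sqrt_real_inner, hV.inner_eq hγ hV s t]

/-- The difference is parallel, so its norm is constant, and it vanishes at `s`. -/
theorem IsParallelAlong.eq_of_eq (hγ : ContMDiff 𝓘(ℝ, ℝ) 𝓘(ℝ, E) ∞ γ)
    (hV : IsParallelAlong γ V) (hW : IsParallelAlong γ W) {s : ℝ} (h : V s = W s) (t : ℝ) :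
    V t = W t := by
  have := (hV.sub hW).norm_eq hγ s t
  simpa [h, sub_eq_zero] using this

/-- Parallel transport is given by any parallel field with the given value. -/
theorem parallelTransport_eq (hγ : ContMDiff 𝓘(ℝ, ℝ) 𝓘(ℝ, E) ∞ γ)
    (hV : IsParallelAlong γ V) (s t : ℝ) : parallelTransport γ s t ⟨γ s, V s⟩ = V t := by
  have hex : ∃ W : ∀ r, TangentSpace 𝓘(ℝ, E) (γ r), IsParallelAlong γ W ∧
      (⟨γ s, W s⟩ : TangentBundle 𝓘(ℝ, E) M) = ⟨γ s, V s⟩ := ⟨V, hV, rfl⟩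
  rw [parallelTransport, dif_pos hex]
  have h2 := hex.choose_spec.2
  simp only [TotalSpace.mk_inj] at h2
  exact hex.choose_spec.1.eq_of_eq hγ hV h2 t

/-- Transport of a single vector, written with a parallel field. -/
theorem exists_parallelTransport_eq (hγ : ContMDiff 𝓘(ℝ, ℝ) 𝓘(ℝ, E) ∞ γ) (s : ℝ)
    (v : TangentSpace 𝓘(ℝ, E) (γ s)) :
    ∃ V : ∀ t, TangentSpace 𝓘(ℝ, E) (γ t), IsParallelAlong γ V ∧ V s = v ∧
      ∀ t, parallelTransport γ s t ⟨γ s, v⟩ = V t := by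
  obtain ⟨V, rfl, hV⟩ := exists_isParallelAlong hγ s v
  exact ⟨V, hV, rfl, fun t ↦ parallelTransport_eq hγ hV s t⟩

end Parallel

/-! ### Geodesic rescaling, the descent lemma, transport as a linear isometry. -/

section Geodesics

variable {E : Type*} [NormedAddCommGroup E] [NormedSpace ℝ E] [FiniteDimensional ℝ E]
  {M : Type*} [TopologicalSpace M] [ChartedSpace E M] [IsManifold 𝓘(ℝ, E) ∞ M]
  [RiemannianBundle (fun x : M ↦ TangentSpace 𝓘(ℝ, E) x)]
  [IsContMDiffRiemannianBundle 𝓘(ℝ, E) ∞ E (fun x : M ↦ TangentSpace 𝓘(ℝ, E) x)]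
  {γ : ℝ → M}

theorem velocity_comp_mul_left (hγ : MDifferentiable 𝓘(ℝ, ℝ) 𝓘(ℝ, E) γ) (r t : ℝ) :
    velocity E (fun s ↦ γ (r * s)) t = r • velocity E γ (r * t) := by
  have h1 : HasMFDerivAt 𝓘(ℝ, ℝ) 𝓘(ℝ, ℝ) (fun s : ℝ ↦ r * s) t
      (ContinuousLinearMap.toSpanSingleton ℝ r) := by
    have : HasDerivAt (fun s : ℝ ↦ r * s) r t := by simpa using (hasDerivAt_id t).const_mul r
    exact this.hasFDerivAt.hasMFDerivAt
  have h2 := ((hγ (r * t)).hasMFDerivAt.comp t h1).mfderiv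
  have h3 := DFunLike.congr_fun h2 (1 : ℝ)
  have h4 := map_smul (mfderiv 𝓘(ℝ, ℝ) 𝓘(ℝ, E) γ (r * t) : ℝ →L[ℝ] E) r (1 : ℝ)
  refine h3.trans (Eq.trans ?_ h4)
  exact congrArg (mfderiv 𝓘(ℝ, ℝ) 𝓘(ℝ, E) γ (r * t) : ℝ →L[ℝ] E)
    (show ContinuousLinearMap.toSpanSingleton ℝ r (1 : ℝ) = r • (1 : ℝ) by simp)

theorem IsParallelAlong.comp_mul_left (hγ : MDifferentiable 𝓘(ℝ, ℝ) 𝓘(ℝ, E) γ)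
    {V : ∀ t, TangentSpace 𝓘(ℝ, E) (γ t)} (hV : IsParallelAlong γ V) (r : ℝ) :
    IsParallelAlong (fun s ↦ γ (r * s)) (fun s ↦ V (r * s)) := by
  rw [isParallelAlong_iff] at *
  intro t c hc
  have := CoordParallelAt.comp_mul_left r (hV (r * t) c hc)
  rw [IsParallelInChart, velocity_comp_mul_left hγ, chartComponents_smul]
  exact this

theorem IsParallelAlong.const_smul {V : ∀ t, TangentSpace 𝓘(ℝ, E) (γ t)}
    (hV : IsParallelAlong γ V) (r : ℝ) : IsParallelAlong γ (fun s ↦ r • V s) := by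
  rw [isParallelAlong_iff] at *
  exact fun t ↦ (hV t).const_smul r

theorem IsParallelAlong.add {V W : ∀ t, TangentSpace 𝓘(ℝ, E) (γ t)}
    (hV : IsParallelAlong γ V) (hW : IsParallelAlong γ W) :
    IsParallelAlong γ (fun s ↦ V s + W s) := by
  rw [isParallelAlong_iff] at *
  exact fun t ↦ (hV t).add (hW t)

/-- Rescaling turns the smoothness inequality, stated between times 0 and 1, into one between times
0 and t. -/
theorem IsGeodesic.comp_mul_left (hγ : IsGeodesic E γ) (r : ℝ) :
    IsGeodesic E (fun s ↦ γ (r * s)) := by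
  have hd : MDifferentiable 𝓘(ℝ, ℝ) 𝓘(ℝ, E) γ := hγ.1.mdifferentiable (by simp)
  refine ⟨hγ.1.comp ?_, ?_⟩
  · exact (contDiff_const.mul contDiff_id).contMDiff
  · have h := (hγ.2.comp_mul_left hd r).const_smul r
    have he : velocity E (fun s ↦ γ (r * s)) = fun s ↦ r • velocity E γ (r * s) :=
      funext fun s ↦ velocity_comp_mul_left hd r s
    rw [he]
    exact h

theorem inner_riemGrad (f : M → ℝ) (x : M) (v : TangentSpace 𝓘(ℝ, E) x) :
    inner ℝ (riemGrad E f x) v = mfderiv 𝓘(ℝ, E) 𝓘(ℝ, ℝ) f x v :=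
  InnerProductSpace.toDual_symm_apply

theorem hasDerivAt_comp_curve {f : M → ℝ} (hf : MDifferentiable 𝓘(ℝ, E) 𝓘(ℝ, ℝ) f)
    (hγ : MDifferentiable 𝓘(ℝ, ℝ) 𝓘(ℝ, E) γ) (t : ℝ) :
    HasDerivAt (fun s ↦ f (γ s)) (inner ℝ (riemGrad E f (γ t)) (velocity E γ t)) t := by
  rw [inner_riemGrad]
  have h := (hf (γ t)).hasMFDerivAt.comp t (hγ t).hasMFDerivAt
  obtain ⟨l, hl, h'⟩ : ∃ l : ℝ →L[ℝ] ℝ,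
      l 1 = mfderiv 𝓘(ℝ, E) 𝓘(ℝ, ℝ) f (γ t) (velocity E γ t) ∧
      HasFDerivAt (fun s ↦ f (γ s)) l t := ⟨_, rfl, hasMFDerivAt_iff_hasFDerivAt.1 h⟩
  exact hl ▸ h'.hasDerivAt

/-- A parallel field whose value at time `1` is the gradient is close to the gradient at
time `0`. -/
theorem GSmooth.norm_sub_le {L : ℝ} {f : M → ℝ} (hf : GSmooth E L f) (hγ : IsGeodesic E γ)
    {V : ∀ t, TangentSpace 𝓘(ℝ, E) (γ t)} (hV : IsParallelAlong γ V)
    (h1 : V 1 = riemGrad E f (γ 1)) :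
    ‖riemGrad E f (γ 0) - V 0‖ ≤ L * ‖velocity E γ 0‖ := by
  have := hf.2 γ hγ
  rwa [← h1, parallelTransport_eq hγ.1 hV] at this

/-- The velocity is parallel, so the left side equals the inner product at time 0 of the initial
velocity with the gradient transported back from time t. Smoothness along the rescaled geodesic and
Cauchy–Schwarz bound the change. -/
theorem GSmooth.inner_velocity_le {L : ℝ} {f : M → ℝ} (hf : GSmooth E L f)
    (hγ : IsGeodesic E γ) {t : ℝ} (ht : 0 ≤ t) :
    inner ℝ (riemGrad E f (γ t)) (velocity E γ t) ≤
      inner ℝ (riemGrad E f (γ 0)) (velocity E γ 0) + L * t * ‖velocity E γ 0‖ ^ 2 := by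
  have hd : MDifferentiable 𝓘(ℝ, ℝ) 𝓘(ℝ, E) γ := hγ.1.mdifferentiable (by simp)
  obtain ⟨V, hVt, hV⟩ := exists_isParallelAlong hγ.1 t (riemGrad E f (γ t))
  -- The rescaled curve is evaluated at `t * 1` and `t * 0`; `hgrad` and `hvel` move between the
  -- tangent spaces there and those at `t` and `0`.
  have hgrad : ∀ s, s = t → V s = riemGrad E f (γ s) := by rintro s rfl; exact hVt
  have h := hf.norm_sub_le (hγ.comp_mul_left t) (hV.comp_mul_left hd t) (hgrad _ (mul_one t))
  have hvel : ∀ s, s = 0 → ‖riemGrad E f (γ s) - V s‖ ≤ L * ‖t • velocity E γ s‖ →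
      ‖riemGrad E f (γ 0) - V 0‖ ≤ L * ‖t • velocity E γ 0‖ := by rintro s rfl h; exact h
  rw [velocity_comp_mul_left hd] at h
  have h0 := hvel _ (mul_zero t) h
  rw [norm_smul, Real.norm_of_nonneg ht] at h0
  rw [← hVt, hV.inner_eq hγ.1 hγ.2 0 t]
  have h2 : inner ℝ (V 0) (velocity E γ 0) = inner ℝ (riemGrad E f (γ 0)) (velocity E γ 0)
      - inner ℝ (riemGrad E f (γ 0) - V 0) (velocity E γ 0) := by
    rw [inner_sub_left]; ring
  have h3 := (abs_real_inner_le_norm (riemGrad E f (γ 0) - V 0) (velocity E γ 0))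
  have h4 : ‖riemGrad E f (γ 0) - V 0‖ * ‖velocity E γ 0‖ ≤
      L * (t * ‖velocity E γ 0‖) * ‖velocity E γ 0‖ := by gcongr
  rw [h2]
  nlinarith [neg_abs_le (inner ℝ (riemGrad E f (γ 0) - V 0) (velocity E γ 0))]

/-- The descent lemma along a geodesic. -/
theorem GSmooth.le_add {L : ℝ} {f : M → ℝ} (hf : GSmooth E L f) (hγ : IsGeodesic E γ) :
    f (γ 1) ≤ f (γ 0) + inner ℝ (riemGrad E f (γ 0)) (velocity E γ 0)
      + L / 2 * ‖velocity E γ 0‖ ^ 2 := by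
  have hd : MDifferentiable 𝓘(ℝ, ℝ) 𝓘(ℝ, E) γ := hγ.1.mdifferentiable (by simp)
  set D : ℝ := inner ℝ (riemGrad E f (γ 0)) (velocity E γ 0) with hD
  set N : ℝ := ‖velocity E γ 0‖ ^ 2 with hN
  -- By `inner_velocity_le` this derivative is nonpositive for t ≥ 0; comparing the values at 0 and
  -- 1 is the claim.
  have hder : ∀ t, HasDerivAt (fun s ↦ f (γ s) - (s * D + L / 2 * s ^ 2 * N))
      (inner ℝ (riemGrad E f (γ t)) (velocity E γ t) - (D + L * t * N)) t := by
    intro t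
    refine (hasDerivAt_comp_curve hf.1 hd t).sub ?_
    have h1 : HasDerivAt (fun s : ℝ ↦ s * D) D t := by
      simpa using (hasDerivAt_id t).mul_const D
    have h2 : HasDerivAt (fun s : ℝ ↦ L / 2 * s ^ 2 * N) (L * t * N) t := by
      refine (((hasDerivAt_pow 2 t).const_mul (L / 2)).mul_const N).congr_deriv ?_
      rw [Nat.add_one_sub_one, pow_one, Nat.cast_ofNat]
      ring
    exact h1.add h2
  have hanti := antitoneOn_of_deriv_nonpos (convex_Icc (0 : ℝ) 1)
    (fun t _ ↦ (hder t).continuousAt.continuousWithinAt)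
    (fun t _ ↦ (hder t).differentiableAt.differentiableWithinAt)
    (fun t ht ↦ by
      rw [interior_Icc] at ht
      rw [(hder t).deriv]
      linarith [hf.inner_velocity_le hγ ht.1.le])
  have := hanti (Set.left_mem_Icc.2 zero_le_one) (Set.right_mem_Icc.2 zero_le_one) zero_le_one
  simp only at this
  linarith

variable {x : M} {v : TangentSpace 𝓘(ℝ, E) x}

theorem GeodesicallyComplete.isGeodesicFrom (hM : GeodesicallyComplete E M) (x : M)
    (v : TangentSpace 𝓘(ℝ, E) x) : IsGeodesicFrom (geodesicFrom x v) x v := by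
  rw [geodesicFrom, dif_pos (hM x v)]
  exact (hM x v).choose_spec

/-- Linear combinations of parallel fields are parallel, so uniqueness gives linearity; constancy of
norms gives isometry. -/
theorem IsGeodesicFrom.exists_linearMap (hγ : IsGeodesicFrom γ x v) :
    ∃ T : TangentSpace 𝓘(ℝ, E) x →ₗ[ℝ] TangentSpace 𝓘(ℝ, E) (γ 1),
      (∀ w, T w = parallelTransport γ 0 1 ⟨x, w⟩) ∧ ∀ w, ‖T w‖ = ‖w‖ := by
  obtain ⟨hg, he⟩ := hγ
  cases he
  choose V hV hV0 hT using fun w ↦ exists_parallelTransport_eq hg.1 0 w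
  refine ⟨⟨⟨fun w ↦ parallelTransport γ 0 1 ⟨γ 0, w⟩, fun w w' ↦ ?_⟩, fun r w ↦ ?_⟩,
    fun w ↦ rfl, fun w ↦ ?_⟩
  · rw [hT, hT, hT]
    exact (hV _).eq_of_eq hg.1 ((hV w).add (hV w')) (s := 0)
      (by simp only [hV0]) 1
  · simp only [hT]
    exact (hV _).eq_of_eq hg.1 ((hV w).const_smul r) (s := 0)
      (by simp only [hV0]) 1
  · change ‖parallelTransport γ 0 1 ⟨γ 0, w⟩‖ = ‖w‖
    rw [hT, (hV w).norm_eq hg.1 0 1, hV0]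

/-- `GSmooth` transports backwards and compares at time 0, the algorithm forwards and at time 1; the
difference of the two parallel fields has the same norm at both times. -/
theorem IsGeodesicFrom.norm_riemGrad_sub_le (hγ : IsGeodesicFrom γ x v) {L : ℝ} {f : M → ℝ}
    (hf : GSmooth E L f) :
    ‖riemGrad E f (γ 1) - parallelTransport γ 0 1 ⟨x, riemGrad E f x⟩‖ ≤ L * ‖v‖ := by
  obtain ⟨hg, he⟩ := hγ
  cases he
  obtain ⟨V, hV, hV0, hT⟩ := exists_parallelTransport_eq hg.1 0 (riemGrad E f (γ 0))
  obtain ⟨W, hW1, hW⟩ := exists_isParallelAlong hg.1 1 (riemGrad E f (γ 1))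
  rw [hT, ← hW1, (hW.sub hV).norm_eq hg.1 0 1, hV0, norm_sub_rev]
  exact hf.norm_sub_le hg hW hW1

theorem IsGeodesicFrom.le_add (hγ : IsGeodesicFrom γ x v) {L : ℝ} {f : M → ℝ}
    (hf : GSmooth E L f) :
    f (γ 1) ≤ f x + inner ℝ (riemGrad E f x) v + L / 2 * ‖v‖ ^ 2 := by
  obtain ⟨hg, he⟩ := hγ
  cases he
  exact hf.le_add hg

end Geodesics

/-! ### Variance of sampling without replacement. -/

section Sampling

variable {ι : Type*} [Fintype ι] [DecidableEq ι]

/-- The number of `b`-element sets that contain both `i` and `j`. -/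
def pairCount (b : ℕ) (i j : ι) : ℕ :=
  ((Finset.powersetCard b (Finset.univ : Finset ι)).filter fun S ↦ i ∈ S ∧ j ∈ S).card

/-- Relabelling by `σ` permutes the `b`-element sets. Hence the count takes one value on the
diagonal and one off it. -/
theorem pairCount_perm (b : ℕ) (σ : Equiv.Perm ι) (i j : ι) :
    pairCount b (σ i) (σ j) = pairCount b i j := by
  symm
  refine Finset.card_bij (fun S _ ↦ S.map σ.toEmbedding) ?_ ?_ ?_
  · intro S hS
    simp only [Finset.mem_filter, Finset.mem_powersetCard_univ] at hS ⊢
    simpa using hS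
  · intro S _ S' _ h
    exact Finset.map_injective _ h
  · intro S hS
    refine ⟨S.map σ.symm.toEmbedding, ?_, ?_⟩
    · simp only [Finset.mem_filter, Finset.mem_powersetCard_univ] at hS ⊢
      simpa [Finset.mem_map_equiv] using hS
    · ext k
      simp [Finset.mem_map_equiv]

theorem pairCount_comm (b : ℕ) (i j : ι) : pairCount b i j = pairCount b j i := by
  simp only [pairCount, and_comm]

theorem pairCount_diag (b : ℕ) (i j : ι) : pairCount b i i = pairCount b j j := by
  simpa using (pairCount_perm b (Equiv.swap i j) i i).symm

theorem pairCount_offDiag (b : ℕ) {i j i' j' : ι} (h : i ≠ j) (h' : i' ≠ j') :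
    pairCount b i j = pairCount b i' j' := by
  -- The transposition of `j` and `k` fixes `i`; with `pairCount_comm`, entries can be changed one
  -- at a time.
  have key : ∀ {i j k : ι}, i ≠ j → i ≠ k → pairCount b i j = pairCount b i k := by
    intro i j k hij hik
    simpa [Equiv.swap_apply_of_ne_of_ne hij hik] using (pairCount_perm b (Equiv.swap j k) i j).symm
  by_cases hi : i' = j
  · subst hi
    rw [pairCount_comm]
    exact key h.symm h'
  · rw [pairCount_comm, key h.symm (Ne.symm hi), pairCount_comm]
    exact key hi h'

theorem sum_pairCount_diag (b : ℕ) :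
    ∑ i : ι, pairCount b i i = (Fintype.card ι).choose b * b := by
  simp only [pairCount, and_self, Finset.card_filter]
  rw [Finset.sum_comm]
  have : ∀ S ∈ Finset.powersetCard b (Finset.univ : Finset ι),
      ∑ i : ι, (if i ∈ S then 1 else 0) = b := by
    intro S hS
    simpa using (Finset.mem_powersetCard.1 hS).2
  rw [Finset.sum_congr rfl this]
  simp [Finset.card_powersetCard]

theorem card_mul_pairCount_diag (b : ℕ) (i : ι) :
    (Fintype.card ι : ℝ) * pairCount b i i = (Fintype.card ι).choose b * b := by
  have h := sum_pairCount_diag (ι := ι) b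
  rw [Finset.sum_congr rfl (fun j _ ↦ pairCount_diag b j i)] at h
  simp only [Finset.sum_const, Finset.card_univ, smul_eq_mul] at h
  exact_mod_cast h

/-- Every index is equally likely to be in a random `b`-element set. -/
theorem sum_powersetCard_sum {H : Type*} [AddCommGroup H] (b : ℕ) (d : ι → H) (hd : ∑ i, d i = 0) :
    ∑ S ∈ Finset.powersetCard b (Finset.univ : Finset ι), ∑ i ∈ S, d i = 0 := by
  rcases isEmpty_or_nonempty ι with hι | ⟨⟨i₀⟩⟩
  · refine Finset.sum_eq_zero fun S _ ↦ Finset.sum_eq_zero fun i _ ↦ isEmptyElim i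
  have h1 : ∀ S : Finset ι, ∑ i ∈ S, d i = ∑ i, if i ∈ S then d i else 0 := fun S ↦ by simp
  simp_rw [h1]
  rw [Finset.sum_comm]
  have h2 : ∀ i, (∑ S ∈ Finset.powersetCard b (Finset.univ : Finset ι),
      if i ∈ S then d i else 0) = pairCount b i₀ i₀ • d i := by
    intro i
    rw [← Finset.sum_filter, Finset.sum_const, pairCount_diag b i₀ i]
    simp [pairCount]
  simp_rw [h2]
  rw [← Finset.smul_sum, hd, smul_zero]

variable {H : Type*} [NormedAddCommGroup H] [InnerProductSpace ℝ H]

/-- Expanding the squares weights each inner product by a pair count: c on the diagonal, q off it.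
As the `d i` sum to zero, only (c - q) ∑ ‖d i‖² remains; then q ≥ 0 is dropped and n c = b · C(n, b)
is used. -/
theorem sum_powersetCard_norm_sq_le (b : ℕ) (d : ι → H) (hd : ∑ i, d i = 0) :
    (Fintype.card ι : ℝ) * ∑ S ∈ Finset.powersetCard b (Finset.univ : Finset ι), ‖∑ i ∈ S, d i‖ ^ 2
      ≤ (Fintype.card ι).choose b * b * ∑ i, ‖d i‖ ^ 2 := by
  have hexp : ∑ S ∈ Finset.powersetCard b (Finset.univ : Finset ι), ‖∑ i ∈ S, d i‖ ^ 2
      = ∑ i, ∑ j, (pairCount b i j : ℝ) * inner ℝ (d i) (d j) := by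
    have h1 : ∀ S : Finset ι, ‖∑ i ∈ S, d i‖ ^ 2 =
        ∑ i, ∑ j, if i ∈ S ∧ j ∈ S then (inner ℝ (d i) (d j) : ℝ) else 0 := by
      intro S
      rw [← real_inner_self_eq_norm_sq, sum_inner]
      simp_rw [inner_sum]
      have h2 : ∀ i, (∑ j, if i ∈ S ∧ j ∈ S then (inner ℝ (d i) (d j) : ℝ) else 0) =
          if i ∈ S then ∑ j ∈ S, (inner ℝ (d i) (d j) : ℝ) else 0 := fun i ↦ by
        split_ifs with hi <;> simp [hi]
      simp [h2]
    simp_rw [h1]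
    rw [Finset.sum_comm]
    refine Finset.sum_congr rfl fun i _ ↦ ?_
    rw [Finset.sum_comm]
    refine Finset.sum_congr rfl fun j _ ↦ ?_
    rw [← Finset.sum_filter, Finset.sum_const, nsmul_eq_mul]
    rfl
  obtain ⟨q, hq0, hq⟩ : ∃ q : ℝ, 0 ≤ q ∧ ∀ i j : ι, i ≠ j → (pairCount b i j : ℝ) = q := by
    by_cases h : ∃ i j : ι, i ≠ j
    · obtain ⟨i, j, hij⟩ := h
      exact ⟨pairCount b i j, by positivity, fun i' j' h' ↦ by rw [pairCount_offDiag b h' hij]⟩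
    · push Not at h
      -- With at most one index there are no off-diagonal pairs, and any q ≥ 0 serves.
      exact ⟨0, le_rfl, fun i j hij ↦ absurd (h i j) hij⟩
  have hsplit : ∀ i, ∑ j, (pairCount b i j : ℝ) * inner ℝ (d i) (d j) =
      (pairCount b i i - q) * ‖d i‖ ^ 2 := by
    intro i
    have h2 : ∀ j, (pairCount b i j : ℝ) * inner ℝ (d i) (d j) =
        q * inner ℝ (d i) (d j) +
          if j = i then ((pairCount b i i : ℝ) - q) * ‖d i‖ ^ 2 else 0 := by
      intro j
      split_ifs with hj
      · subst hj
        rw [← real_inner_self_eq_norm_sq]; ring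
      · rw [hq i j (Ne.symm hj)]; ring
    simp_rw [h2]
    rw [Finset.sum_add_distrib, ← Finset.mul_sum, ← inner_sum, hd]
    simp
  rw [hexp, Finset.mul_sum, Finset.mul_sum]
  refine Finset.sum_le_sum fun i _ ↦ ?_
  rw [hsplit, ← card_mul_pairCount_diag b i, ← mul_assoc]
  gcongr
  linarith

/-- The mean square of a fixed vector plus the sampling error of a minibatch drawn without
replacement. -/
theorem avg_norm_sq_le [Nonempty ι] {b : ℕ} (hb : 0 < b) (hbn : b ≤ Fintype.card ι) (e : H)
    (a : ι → H) {R : ℝ} (ha : ∀ i, ‖a i‖ ≤ R) :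
    ((Fintype.card ι).choose b : ℝ)⁻¹ * ∑ S ∈ Finset.powersetCard b (Finset.univ : Finset ι),
      ‖e + ((b : ℝ)⁻¹ • ∑ i ∈ S, a i - (Fintype.card ι : ℝ)⁻¹ • ∑ i, a i)‖ ^ 2
      ≤ ‖e‖ ^ 2 + R ^ 2 / b := by
  set n := Fintype.card ι with hn
  have hn0 : (0 : ℝ) < n := by exact_mod_cast Fintype.card_pos
  have hb0 : (0 : ℝ) < b := by exact_mod_cast hb
  have hN : (0 : ℝ) < n.choose b := by exact_mod_cast Nat.choose_pos hbn
  set m : H := (n : ℝ)⁻¹ • ∑ i, a i with hm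
  set d : ι → H := fun i ↦ a i - m with hdd
  have hnm : (n : ℝ) • m = ∑ i, a i := by rw [hm, smul_inv_smul₀ hn0.ne']
  have hd : ∑ i, d i = 0 := by
    simp only [hdd, Finset.sum_sub_distrib, Finset.sum_const, Finset.card_univ, ← hn,
      ← Nat.cast_smul_eq_nsmul ℝ, hnm, sub_self]
  have hS : ∀ S ∈ Finset.powersetCard b (Finset.univ : Finset ι),
      ‖e + ((b : ℝ)⁻¹ • ∑ i ∈ S, a i - m)‖ ^ 2 = ‖e‖ ^ 2
        + 2 * (b : ℝ)⁻¹ * inner ℝ e (∑ i ∈ S, d i) + ((b : ℝ)⁻¹) ^ 2 * ‖∑ i ∈ S, d i‖ ^ 2 := by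
    intro S hS
    have hc := (Finset.mem_powersetCard.1 hS).2
    have : (b : ℝ)⁻¹ • ∑ i ∈ S, a i - m = (b : ℝ)⁻¹ • ∑ i ∈ S, d i := by
      simp only [hdd, Finset.sum_sub_distrib, Finset.sum_const, hc,
        ← Nat.cast_smul_eq_nsmul ℝ, smul_sub, inv_smul_smul₀ hb0.ne']
    rw [this, norm_add_sq_real, norm_smul, real_inner_smul_right, mul_pow, norm_inv,
      Real.norm_of_nonneg hb0.le]
    ring
  rw [Finset.sum_congr rfl hS, Finset.sum_add_distrib, Finset.sum_add_distrib, ← Finset.mul_sum,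
    ← Finset.mul_sum, ← inner_sum, sum_powersetCard_sum b d hd, inner_zero_right, mul_zero,
    add_zero, Finset.sum_const, Finset.card_powersetCard, Finset.card_univ, ← hn, nsmul_eq_mul]
  have hvar := sum_powersetCard_norm_sq_le b d hd
  rw [← hn] at hvar
  -- Centring at the mean `m` only lowers the sum of squares, by n‖m‖².
  have hdR : ∑ i, ‖d i‖ ^ 2 ≤ n * R ^ 2 := by
    have h1 : ∑ i, ‖d i‖ ^ 2 = ∑ i, ‖a i‖ ^ 2 - n * ‖m‖ ^ 2 := by
      have : ∀ i, ‖d i‖ ^ 2 = ‖a i‖ ^ 2 - 2 * inner ℝ (a i) m + ‖m‖ ^ 2 := fun i ↦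
        norm_sub_sq_real _ _
      simp_rw [this]
      rw [Finset.sum_add_distrib, Finset.sum_sub_distrib, ← Finset.mul_sum, ← sum_inner, ← hnm,
        real_inner_smul_left, real_inner_self_eq_norm_sq, Finset.sum_const, Finset.card_univ,
        ← hn, nsmul_eq_mul]
      ring
    have h2 : ∑ i, ‖a i‖ ^ 2 ≤ ∑ _i : ι, R ^ 2 := Finset.sum_le_sum fun i _ ↦ by
      gcongr
      exact ha i
    rw [Finset.sum_const, Finset.card_univ, ← hn, nsmul_eq_mul] at h2
    have : 0 ≤ n * ‖m‖ ^ 2 := by positivity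
    linarith
  set Q := ∑ S ∈ Finset.powersetCard b (Finset.univ : Finset ι), ‖∑ i ∈ S, d i‖ ^ 2
  have hQ : Q ≤ n.choose b * b * R ^ 2 := by
    have h3 : (n : ℝ) * Q ≤ n * (n.choose b * b * R ^ 2) := by
      calc (n : ℝ) * Q ≤ n.choose b * b * ∑ i, ‖d i‖ ^ 2 := hvar
        _ ≤ n.choose b * b * (n * R ^ 2) := by gcongr
        _ = _ := by ring
    exact le_of_mul_le_mul_left h3 hn0
  rw [mul_add, inv_mul_cancel_left₀ hN.ne']
  have h4 : (n.choose b : ℝ)⁻¹ * (((b : ℝ)⁻¹) ^ 2 * Q) ≤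
      (n.choose b : ℝ)⁻¹ * (((b : ℝ)⁻¹) ^ 2 * (n.choose b * b * R ^ 2)) := by gcongr
  have h5 : (n.choose b : ℝ)⁻¹ * (((b : ℝ)⁻¹) ^ 2 * (n.choose b * b * R ^ 2)) = R ^ 2 / b := by
    field_simp
  linarith

end Sampling

/-! ### Integrals against the laws of coin and minibatches. -/

section Laws

instance (n m : ℕ) : Fintype (Batch n m) :=
  inferInstanceAs (Fintype {S : Finset (Fin n) // S.card = m})

instance (n m : ℕ) : MeasurableSingletonClass (Batch n m) := ⟨fun _ ↦ trivial⟩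

theorem integral_uniformOn_univ {α : Type*} [Fintype α] [MeasurableSpace α]
    [MeasurableSingletonClass α] (h : α → ℝ) :
    ∫ a, h a ∂(uniformOn (Set.univ : Set α)) = (Fintype.card α : ℝ)⁻¹ * ∑ a, h a := by
  rw [integral_fintype Integrable.of_finite, Finset.mul_sum]
  refine Finset.sum_congr rfl fun a _ ↦ ?_
  rw [measureReal_def, uniformOn_univ]
  simp

theorem card_batch (n b : ℕ) : Fintype.card (Batch n b) = n.choose b := by
  have := Fintype.card_finset_len (α := Fin n) b
  rw [Fintype.card_fin] at this
  rw [← this]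
  exact Fintype.card_congr (Equiv.refl _)

theorem sum_batch (n b : ℕ) (h : Finset (Fin n) → ℝ) :
    ∑ S : Batch n b, h S.1 = ∑ S ∈ Finset.powersetCard b Finset.univ, h S :=
  (Finset.sum_subtype (p := fun S : Finset (Fin n) ↦ S.card = b) _ (fun S ↦ by simp) h).symm

theorem isProbabilityMeasure_uniformOn_batch {n b : ℕ} (hb : b ≤ n) :
    IsProbabilityMeasure (uniformOn (Set.univ : Set (Batch n b))) := by
  have : 0 < Fintype.card (Batch n b) := by rw [card_batch]; exact Nat.choose_pos hb
  have : Nonempty (Batch n b) := Fintype.card_pos_iff.1 this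
  exact isProbabilityMeasure_uniformOn Set.finite_univ Set.univ_nonempty

instance (p : ℝ) : IsFiniteMeasure (coinLaw p) := by
  have := Measure.smul_finite (Measure.dirac true) (c := ENNReal.ofReal p) ENNReal.ofReal_ne_top
  have := Measure.smul_finite (Measure.dirac false) (c := ENNReal.ofReal (1 - p))
    ENNReal.ofReal_ne_top
  unfold coinLaw
  infer_instance

theorem integral_coinLaw {p : ℝ} (hp₀ : 0 ≤ p) (hp₁ : p ≤ 1) (h : Bool → ℝ) :
    ∫ a, h a ∂(coinLaw p) = p * h true + (1 - p) * h false := by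
  have := Measure.smul_finite (Measure.dirac true) (c := ENNReal.ofReal p) ENNReal.ofReal_ne_top
  have := Measure.smul_finite (Measure.dirac false) (c := ENNReal.ofReal (1 - p))
    ENNReal.ofReal_ne_top
  unfold coinLaw
  rw [integral_add_measure Integrable.of_finite Integrable.of_finite, integral_smul_measure,
    integral_smul_measure, integral_dirac, integral_dirac, ENNReal.toReal_ofReal hp₀,
    ENNReal.toReal_ofReal (by linarith), smul_eq_mul, smul_eq_mul]

/-- The condition `B ≤ n` makes the law of the large minibatch a probability measure, so that
minibatch, absent from the integrand, integrates out. -/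
theorem integral_sampleLaw {n B b : ℕ} (hB : B ≤ n) {p : ℝ} (hp₀ : 0 ≤ p)
    (hp₁ : p ≤ 1) (h : Bool → Batch n b → ℝ) :
    ∫ s, h s.1 s.2.2 ∂(sampleLaw n B b p) =
      p * ((n.choose b : ℝ)⁻¹ * ∑ S, h true S) + (1 - p) * ((n.choose b : ℝ)⁻¹ * ∑ S, h false S) := by
  have := isProbabilityMeasure_uniformOn_batch hB
  unfold sampleLaw
  rw [integral_prod _ Integrable.of_finite, integral_coinLaw hp₀ hp₁]
  have key : ∀ c, ∫ y : Batch n B × Batch n b, h c y.2 ∂((uniformOn Set.univ).prod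
      (uniformOn Set.univ)) = (n.choose b : ℝ)⁻¹ * ∑ S, h c S := by
    intro c
    rw [integral_fun_snd (h c), integral_uniformOn_univ, card_batch]
    simp
  rw [key, key]

end Laws

/-! ### One iteration: expected decrease of the potential. -/

section Step

variable {E : Type*} [NormedAddCommGroup E] [NormedSpace ℝ E] [FiniteDimensional ℝ E]
  {M : Type*} [TopologicalSpace M] [ChartedSpace E M] [IsManifold 𝓘(ℝ, E) ∞ M]
  [RiemannianBundle (fun x : M ↦ TangentSpace 𝓘(ℝ, E) x)]
  [IsContMDiffRiemannianBundle 𝓘(ℝ, E) ∞ E (fun x : M ↦ TangentSpace 𝓘(ℝ, E) x)]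
  {n : ℕ} {f : Fin n → M → ℝ}

theorem riemGrad_objective (hf : ∀ i, MDifferentiable 𝓘(ℝ, E) 𝓘(ℝ, ℝ) (f i)) (x : M) :
    riemGrad E (objective f) x = (n : ℝ)⁻¹ • ∑ i, riemGrad E (f i) x := by
  refine ext_inner_right ℝ fun w ↦ ?_
  rw [inner_riemGrad, real_inner_smul_left, sum_inner]
  simp_rw [inner_riemGrad]
  have h := (HasMFDerivAt.sum (t := Finset.univ)
    (fun i _ ↦ (hf i x).hasMFDerivAt)).const_smul (n : ℝ)⁻¹
  have he : objective f = (n : ℝ)⁻¹ • ∑ i, f i := by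
    ext x
    simp [objective]
  rw [he]
  have h2 := DFunLike.congr_fun h.mfderiv w
  rw [h2]
  have key : ∀ (r : ℝ) (l : Fin n → E →L[ℝ] ℝ) (w : E), (r • ∑ i, l i) w = r * ∑ i, l i w := by
    intro r l w
    simp
  exact key _ (fun i ↦ mfderiv 𝓘(ℝ, E) 𝓘(ℝ, ℝ) (f i) x) w

theorem batchGrad_full (hf : ∀ i, MDifferentiable 𝓘(ℝ, E) 𝓘(ℝ, ℝ) (f i)) (S : Batch n n) (x : M) :
    batchGrad E f S x = riemGrad E (objective f) x := by
  have : S.1 = Finset.univ := (Finset.card_eq_iff_eq_univ _).1 (by simpa using S.2)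
  rw [riemGrad_objective hf, batchGrad, this]

/-- The Lyapunov function of the method. -/
noncomputable def potential (f : Fin n → M → ℝ) (fstar η p : ℝ) (z : TangentBundle 𝓘(ℝ, E) M) : ℝ :=
  objective f z.1 - fstar + η / (2 * p) * ‖z.2 - riemGrad E (objective f) z.1‖ ^ 2

/-- With a = Lη and r the square root, the bound on η says a + ar ≤ 1. So 0 ≤ ar ≤ 1, hence (ar)² ≤
ar and a + (ar)² ≤ 1. -/
theorem stepsize_condition {L p η : ℝ} {b : ℕ} (hL : 0 < L) (hp₀ : 0 < p) (hp₁ : p ≤ 1)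
    (hη₀ : 0 < η) (hη : η ≤ 1 / (L * (1 + √((1 - p) / (p * b))))) :
    L * η + (1 - p) / (p * b) * (L * η) ^ 2 ≤ 1 := by
  set r := √((1 - p) / (p * b)) with hr
  have hr0 : 0 ≤ r := Real.sqrt_nonneg _
  have hq : (1 - p) / (p * b) = r ^ 2 :=
    (Real.sq_sqrt (div_nonneg (by linarith) (by positivity))).symm
  rw [le_div_iff₀ (by positivity)] at hη
  rw [hq]
  set a := L * η with ha
  have ha0 : 0 < a := by positivity
  have h1 : a + a * r ≤ 1 := by rw [ha]; linarith
  have h2 : 0 ≤ a * r := by positivity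
  nlinarith

theorem objective_riemExp_le (hM : GeodesicallyComplete E M) {L : ℝ} (hf : ∀ i, GSmooth E L (f i))
    (hn : 0 < n) (x : M) (v : TangentSpace 𝓘(ℝ, E) x) :
    objective f (riemExp x v) ≤ objective f x + inner ℝ (riemGrad E (objective f) x) v
      + L / 2 * ‖v‖ ^ 2 := by
  have hn' : (0 : ℝ) < n := by exact_mod_cast hn
  have h1 : ∑ i, f i (riemExp x v) ≤
      ∑ i, (f i x + inner ℝ (riemGrad E (f i) x) v + L / 2 * ‖v‖ ^ 2) :=
    Finset.sum_le_sum fun i _ ↦ (hM.isGeodesicFrom x v).le_add (hf i)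
  rw [riemGrad_objective (fun i ↦ (hf i).1), real_inner_smul_left, sum_inner]
  rw [Finset.sum_add_distrib, Finset.sum_add_distrib, Finset.sum_const, Finset.card_univ,
    Fintype.card_fin, nsmul_eq_mul] at h1
  unfold objective
  calc (n : ℝ)⁻¹ * ∑ i, f i (riemExp x v) ≤ (n : ℝ)⁻¹ *
        (∑ i, f i x + ∑ i, inner ℝ (riemGrad E (f i) x) v + n * (L / 2 * ‖v‖ ^ 2)) := by gcongr
    _ = _ := by rw [mul_add, mul_add, inv_mul_cancel_left₀ hn'.ne']

theorem GeodesicallyComplete.exists_linearMap (hM : GeodesicallyComplete E M) (x : M)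
    (v : TangentSpace 𝓘(ℝ, E) x) :
    ∃ T : TangentSpace 𝓘(ℝ, E) x →ₗ[ℝ] TangentSpace 𝓘(ℝ, E) (riemExp x v),
      (∀ w, expTransport x v w = T w) ∧ ∀ w, ‖T w‖ = ‖w‖ := by
  obtain ⟨T, hT, hnorm⟩ := (hM.isGeodesicFrom x v).exists_linearMap
  exact ⟨T, fun w ↦ (hT w).symm, hnorm⟩

theorem GeodesicallyComplete.norm_riemGrad_sub_le (hM : GeodesicallyComplete E M) (x : M)
    (v : TangentSpace 𝓘(ℝ, E) x) {L : ℝ} {h : M → ℝ} (hh : GSmooth E L h) :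
    ‖riemGrad E h (riemExp x v) - expTransport x v (riemGrad E h x)‖ ≤ L * ‖v‖ :=
  (hM.isGeodesicFrom x v).norm_riemGrad_sub_le hh

/-- The mean square error of the recursive gradient estimator. -/
theorem avg_error_le (hM : GeodesicallyComplete E M) {L : ℝ} (hf : ∀ i, GSmooth E L (f i))
    {b : ℕ} (hb₀ : 0 < b) (hb : b ≤ n) (x : M) (g v : TangentSpace 𝓘(ℝ, E) x) :
    (n.choose b : ℝ)⁻¹ * ∑ S : Batch n b, ‖expTransport x v g + batchGrad E f S (riemExp x v)
      - expTransport x v (batchGrad E f S x) - riemGrad E (objective f) (riemExp x v)‖ ^ 2 ≤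
    ‖g - riemGrad E (objective f) x‖ ^ 2 + (L * ‖v‖) ^ 2 / b := by
  have hfd := fun i ↦ (hf i).1
  obtain ⟨T, hT, hnorm⟩ := hM.exists_linearMap x v
  set a : Fin n → TangentSpace 𝓘(ℝ, E) (riemExp x v) := fun i ↦
    riemGrad E (f i) (riemExp x v) - T (riemGrad E (f i) x) with ha
  have haL : ∀ i, ‖a i‖ ≤ L * ‖v‖ := fun i ↦ by
    have := hM.norm_riemGrad_sub_le x v (hf i)
    rw [hT] at this
    exact this
  have : Nonempty (Fin n) := ⟨⟨0, hb₀.trans_le hb⟩⟩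
  have hmain := avg_norm_sq_le hb₀ (by simpa using hb) (T (g - riemGrad E (objective f) x)) a haL
  rw [Fintype.card_fin] at hmain
  -- By linearity of `T`, the estimator error is `T (g - ∇f x)` plus the minibatch mean of `a` minus
  -- its full mean.
  rw [← hnorm (g - riemGrad E (objective f) x)]
  refine le_trans (le_of_eq ?_) hmain
  rw [← sum_batch n b (fun S ↦ ‖T (g - riemGrad E (objective f) x)
    + ((b : ℝ)⁻¹ • ∑ i ∈ S, a i - (n : ℝ)⁻¹ • ∑ i, a i)‖ ^ 2)]
  congr 1
  refine Finset.sum_congr rfl fun S _ ↦ ?_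
  congr 2
  simp only [hT, batchGrad, riemGrad_objective hfd, ha, map_sub, map_smul, map_sum,
    Finset.sum_sub_distrib, smul_sub]
  abel

variable {L p η fstar : ℝ} {b : ℕ}

/-- Since (1 - p) η/(2p) = η/(2p) - η/2, the contraction of the error by the coin absorbs the term
η/2 ‖g - ∇f‖² of the descent lemma. What is left multiplies ‖g‖² and is handled by
`stepsize_condition`. -/
theorem integral_potential_rpageStep_le (hM : GeodesicallyComplete E M) (hL : 0 < L)
    (hf : ∀ i, GSmooth E L (f i)) (hp₀ : 0 < p) (hp₁ : p ≤ 1) (hb₀ : 0 < b) (hb : b < n)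
    (hη₀ : 0 < η) (hη : η ≤ 1 / (L * (1 + √((1 - p) / (p * b)))))
    (z : TangentBundle 𝓘(ℝ, E) M) :
    ∫ s, potential f fstar η p (rpageStep f η z s) ∂(sampleLaw n n b p) ≤
      potential f fstar η p z - η / 2 * ‖riemGrad E (objective f) z.1‖ ^ 2 := by
  obtain ⟨x, g⟩ := z
  have hfd := fun i ↦ (hf i).1
  set v : TangentSpace 𝓘(ℝ, E) x := -(η • g) with hv
  set y := riemExp x v with hy
  set er : Batch n b → ℝ := fun S ↦ ‖expTransport x v g + batchGrad E f S (riemExp x v)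
      - expTransport x v (batchGrad E f S x) - riemGrad E (objective f) (riemExp x v)‖ ^ 2 with her
  set h : Bool → Batch n b → ℝ := fun c S ↦ objective f y - fstar +
    η / (2 * p) * if c = true then 0 else er S with hh
  have hstep : ∀ s : Sample n n b,
      potential f fstar η p (rpageStep f η ⟨x, g⟩ s) = h s.1 s.2.2 := by
    rintro ⟨c, S, S'⟩
    cases c
    · rfl
    · change objective f y - fstar + η / (2 * p) *
        ‖batchGrad E f S y - riemGrad E (objective f) y‖ ^ 2 = _
      simp [hh, batchGrad_full hfd]
  rw [integral_congr_ae (.of_forall hstep), integral_sampleLaw le_rfl hp₀.le hp₁ h]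
  have hN : (0 : ℝ) < n.choose b := by exact_mod_cast Nat.choose_pos hb.le
  have hcard : (Finset.univ : Finset (Batch n b)).card = n.choose b := card_batch n b
  have herr := avg_error_le hM hf hb₀ hb.le x g v
  rw [← her] at herr
  have hdesc := objective_riemExp_le hM hf (hb₀.trans hb) x v
  have hvn : ‖v‖ = η * ‖g‖ := by rw [hv, norm_neg, norm_smul, Real.norm_of_nonneg hη₀.le]
  rw [hvn] at herr hdesc
  set F := riemGrad E (objective f) x with hF
  have hinner : inner ℝ F v = -(η / 2) * (‖g‖ ^ 2 + ‖F‖ ^ 2 - ‖g - F‖ ^ 2) := by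
    rw [norm_sub_sq_real, hv, inner_neg_right, real_inner_smul_right, real_inner_comm]
    ring
  rw [hinner] at hdesc
  simp only [hh, if_true, Bool.false_eq_true, if_false, Finset.sum_add_distrib, Finset.sum_const,
    hcard, nsmul_eq_mul, ← Finset.mul_sum, mul_zero, add_zero]
  rw [mul_add, inv_mul_cancel_left₀ hN.ne', mul_left_comm (n.choose b : ℝ)⁻¹]
  set Av := (n.choose b : ℝ)⁻¹ * ∑ S, er S
  have hcond := stepsize_condition hL hp₀ hp₁ hη₀ hη
  have hb' : (0 : ℝ) < b := by exact_mod_cast hb₀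
  change _ ≤ objective f x - fstar + η / (2 * p) * ‖g - F‖ ^ 2 - η / 2 * ‖F‖ ^ 2
  have h1 : (1 - p) * (η / (2 * p) * Av) ≤
      (1 - p) * (η / (2 * p) * (‖g - F‖ ^ 2 + (L * (η * ‖g‖)) ^ 2 / b)) := by
    have : 0 ≤ 1 - p := by linarith
    gcongr
  have h2 : (1 - p) * (η / (2 * p) * (‖g - F‖ ^ 2 + (L * (η * ‖g‖)) ^ 2 / b)) =
      η / (2 * p) * ‖g - F‖ ^ 2 - η / 2 * ‖g - F‖ ^ 2
        + η / 2 * ‖g‖ ^ 2 * ((1 - p) / (p * b) * (L * η) ^ 2) := by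
    field_simp
  have h3 : η / 2 * ‖g‖ ^ 2 * (L * η + (1 - p) / (p * b) * (L * η) ^ 2) ≤ η / 2 * ‖g‖ ^ 2 * 1 := by
    gcongr
  nlinarith

end Step

/-! ### Expectations of functions of finite-valued random variables. -/

section Independence

variable {Ω α β : Type*} [MeasurableSpace Ω] {P : Measure Ω} [IsProbabilityMeasure P]
  [MeasurableSpace α] [Finite α] [MeasurableSingletonClass α]
  [MeasurableSpace β] [Finite β] [MeasurableSingletonClass β]

/-- Finiteness of the range removes any need for measurability of the exponential map or of
transport. -/
theorem integrable_comp_of_finite {X : Ω → α} (hX : Measurable X) (h : α → ℝ) :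
    Integrable (fun o ↦ h (X o)) P := by
  have := Measure.isProbabilityMeasure_map (μ := P) hX.aemeasurable
  exact (Integrable.of_finite (μ := P.map X) (f := h)).comp_measurable hX

theorem integral_comp_of_finite {X : Ω → α} (hX : Measurable X) (h : α → ℝ) :
    ∫ o, h (X o) ∂P = ∫ a, h a ∂(P.map X) :=
  (integral_map hX.aemeasurable (by
    have := Measure.isProbabilityMeasure_map (μ := P) hX.aemeasurable
    exact (Integrable.of_finite (f := h)).aestronglyMeasurable)).symm

theorem integral_comp_of_indepFun {X : Ω → α} {Y : Ω → β} (hX : Measurable X) (hY : Measurable Y)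
    (hXY : IndepFun X Y P) (h : α → β → ℝ) :
    ∫ o, h (X o) (Y o) ∂P = ∫ o, ∫ b, h (X o) b ∂(P.map Y) ∂P := by
  have := Measure.isProbabilityMeasure_map (μ := P) hX.aemeasurable
  have := Measure.isProbabilityMeasure_map (μ := P) hY.aemeasurable
  rw [integral_comp_of_finite hX (fun a ↦ ∫ b, h a b ∂(P.map Y)),
    integral_comp_of_finite (hX.prodMk hY) (fun q : α × β ↦ h q.1 q.2),
    (indepFun_iff_map_prod_eq_prod_map_map hX.aemeasurable hY.aemeasurable).1 hXY,
    integral_prod _ Integrable.of_finite]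

end Independence

section Histories

variable {S : Type*}

/-- A sequence with given values at the times `0, …, k`. -/
def extendHistory (s₀ : S) (k : ℕ) (w : Finset.range (k + 1) → S) (j : ℕ) : S :=
  if h : j ∈ Finset.range (k + 1) then w ⟨j, h⟩ else s₀

theorem extendHistory_apply (s₀ : S) {k j : ℕ} (s : ℕ → S) (hj : j ≤ k) :
    extendHistory s₀ k (fun i ↦ s i) j = s j := by
  rw [extendHistory, dif_pos (Finset.mem_range.2 (Nat.lt_succ_of_le hj))]

end Histories

/-! ### The iterates as functions of the sample history. -/

section Convergence

variable {E : Type*} [NormedAddCommGroup E] [NormedSpace ℝ E] [FiniteDimensional ℝ E]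
  {M : Type*} [TopologicalSpace M] [ChartedSpace E M]
  [RiemannianBundle (fun x : M ↦ TangentSpace 𝓘(ℝ, E) x)]
  {n B b K : ℕ} {f : Fin n → M → ℝ} {η p : ℝ} {x₀ : M}

theorem rpage_congr {s s' : ℕ → Sample n B b} {k : ℕ} (h : ∀ j ≤ k, s j = s' j) :
    rpage E f η x₀ s k = rpage E f η x₀ s' k := by
  induction k with
  | zero => simp only [rpage, h 0 le_rfl]
  | succ k ih => simp only [rpage, ih fun j hj ↦ h j (hj.trans k.le_succ), h (k + 1) le_rfl]

variable {Ω : Type*} [MeasurableSpace Ω] {P : Measure Ω} [IsProbabilityMeasure P]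
  {ξ : ℕ → Ω → Sample n B b} {J : Ω → Fin K}

/-- The iterates up to time `k` are functions of the history up to time `k`. -/
theorem rpage_extendHistory (s₀ : Sample n B b) (s : ℕ → Sample n B b) {j k : ℕ} (hj : j ≤ k) :
    rpage E f η x₀ (extendHistory s₀ k fun i ↦ s i) j = rpage E f η x₀ s j :=
  rpage_congr fun _ hi ↦ extendHistory_apply s₀ s (hi.trans hj)

theorem IsSampling.measurable_history (h : IsSampling P p ξ J) (k : ℕ) :
    Measurable fun o (i : Finset.range (k + 1)) ↦ ξ i o :=
  measurable_pi_lambda _ fun i ↦ h.measurable_sample i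

theorem IsSampling.integrable_rpage (h : IsSampling P p ξ J) (k : ℕ)
    (q : TangentBundle 𝓘(ℝ, E) M → ℝ) :
    Integrable (fun o ↦ q (rpage E f η x₀ (fun j ↦ ξ j o) k)) P := by
  -- The sample `ξ 0 o₀` merely fills the sequence after time `k`, where it has no effect on the
  -- iterate.
  obtain ⟨o₀⟩ := nonempty_of_isProbabilityMeasure P
  have := integrable_comp_of_finite (P := P) (h.measurable_history k)
    (fun w ↦ q (rpage E f η x₀ (extendHistory (ξ 0 o₀) k w) k))
  refine this.congr (.of_forall fun o ↦ ?_)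
  exact congrArg q (rpage_extendHistory (ξ 0 o₀) (fun j ↦ ξ j o) le_rfl)

/-- The tower property: the iterate at time `k` depends on samples `0, …, k`, which are independent
of the sample used next. -/
theorem IsSampling.integral_rpage_succ (h : IsSampling P p ξ J) (k : ℕ)
    (q : TangentBundle 𝓘(ℝ, E) M → ℝ) :
    ∫ o, q (rpage E f η x₀ (fun j ↦ ξ j o) (k + 1)) ∂P =
      ∫ o, ∫ s, q (rpageStep f η (rpage E f η x₀ (fun j ↦ ξ j o) k) s) ∂(sampleLaw n B b p) ∂P := by
  obtain ⟨o₀⟩ := nonempty_of_isProbabilityMeasure P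
  have hind : IndepFun (fun o (i : Finset.range (k + 1)) ↦ ξ i o) (ξ (k + 1)) P := by
    have h1 := h.indep_samples.indepFun_finset (Finset.range (k + 1)) {k + 1} (by simp)
      h.measurable_sample
    exact h1.comp measurable_id
      (measurable_pi_apply (⟨k + 1, Finset.mem_singleton_self _⟩ : ({k + 1} : Finset ℕ)))
  have h2 := integral_comp_of_indepFun (h.measurable_history k) (h.measurable_sample (k + 1)) hind
    (fun w s ↦ q (rpageStep f η (rpage E f η x₀ (extendHistory (ξ 0 o₀) k w) k) s))
  rw [h.law_sample (k + 1)] at h2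
  simp only [fun o ↦ rpage_extendHistory (E := E) (f := f) (η := η) (x₀ := x₀) (ξ 0 o₀)
    (fun j ↦ ξ j o) (le_refl k)] at h2
  exact h2

/-- The index is independent of the whole history, so Fubini replaces it by a uniform average over
the times. -/
theorem IsSampling.integral_rpage_index (h : IsSampling P p ξ J)
    (q : TangentBundle 𝓘(ℝ, E) M → ℝ) :
    Integrable (fun o ↦ q (rpage E f η x₀ (fun j ↦ ξ j o) (J o))) P ∧
    ∫ o, q (rpage E f η x₀ (fun j ↦ ξ j o) (J o)) ∂P =
      (K : ℝ)⁻¹ * ∑ k ∈ Finset.range K, ∫ o, q (rpage E f η x₀ (fun j ↦ ξ j o) k) ∂P := by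
  obtain ⟨o₀⟩ := nonempty_of_isProbabilityMeasure P
  have hind : IndepFun (fun o (i : Finset.range (K + 1)) ↦ ξ i o) J P := by
    have hm : Measurable fun (s : ℕ → Sample n B b) (i : Finset.range (K + 1)) ↦ s i :=
      measurable_pi_lambda _ fun i ↦ measurable_pi_apply _
    exact (h.indep_index.comp measurable_id hm).symm
  set Q : (Finset.range (K + 1) → Sample n B b) → Fin K → ℝ := fun w j ↦
    q (rpage E f η x₀ (extendHistory (ξ 0 o₀) K w) j) with hQ
  have hQ' : ∀ o (j : Fin K), Q (fun i ↦ ξ i o) j = q (rpage E f η x₀ (fun j ↦ ξ j o) j) :=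
    fun o j ↦ congrArg q (rpage_extendHistory (ξ 0 o₀) (fun j ↦ ξ j o) j.2.le)
  constructor
  · refine (integrable_comp_of_finite (P := P) ((h.measurable_history K).prodMk
      h.measurable_index) (fun r ↦ Q r.1 r.2)).congr (.of_forall fun o ↦ hQ' o (J o))
  · have h2 := integral_comp_of_indepFun (h.measurable_history K) h.measurable_index hind Q
    rw [h.law_index] at h2
    simp only [integral_uniformOn_univ, hQ', Fintype.card_fin] at h2
    rw [h2, integral_const_mul, integral_finsetSum _ fun (j : Fin K) _ ↦
      h.integrable_rpage (E := E) (f := f) (η := η) (x₀ := x₀) j q,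
      ← Fin.sum_univ_eq_sum_range (fun k ↦ ∫ o, q (rpage E f η x₀ (fun j ↦ ξ j o) k) ∂P)]

end Convergence

end RPage

/-! ### Telescoping the potential. -/

theorem theorem2
    {E : Type*} [NormedAddCommGroup E] [NormedSpace ℝ E] [FiniteDimensional ℝ E]
    {M : Type*} [TopologicalSpace M] [T2Space M] [ChartedSpace E M] [IsManifold 𝓘(ℝ, E) ∞ M]
    [RiemannianBundle (fun x : M ↦ TangentSpace 𝓘(ℝ, E) x)]
    [IsContMDiffRiemannianBundle 𝓘(ℝ, E) ∞ E (fun x : M ↦ TangentSpace 𝓘(ℝ, E) x)]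
    (hM : GeodesicallyComplete E M)
    {n : ℕ} (f : Fin n → M → ℝ) (L : ℝ) (hL : 0 < L) (hf : ∀ i, GSmooth E L (f i))
    (fstar : ℝ) (hfstar : ∀ x, fstar ≤ objective f x)
    (x₀ : M) (p : ℝ) (hp₀ : 0 < p) (hp₁ : p ≤ 1)
    (B b : ℕ) (hB : B = n) (hb₀ : 0 < b) (hb : b < B)
    (η : ℝ) (hη₀ : 0 < η) (hη : η ≤ 1 / (L * (1 + √((1 - p) / (p * b)))))
    (K : ℕ) (hK : 0 < K)
    {Ω : Type*} [MeasurableSpace Ω] (P : Measure Ω) [IsProbabilityMeasure P]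
    (ξ : ℕ → Ω → Sample n B b) (J : Ω → Fin K) (hsamp : IsSampling P p ξ J) :
    Integrable
        (fun o ↦ ‖riemGrad E (objective f) (rpage E f η x₀ (fun k ↦ ξ k o) (J o)).1‖ ^ 2) P ∧
      ∫ o, ‖riemGrad E (objective f) (rpage E f η x₀ (fun k ↦ ξ k o) (J o)).1‖ ^ 2 ∂P
        ≤ 2 * (objective f x₀ - fstar) / (η * K) := by
  subst hB
  obtain ⟨hint, heq⟩ := hsamp.integral_rpage_index (E := E) (f := f) (η := η) (x₀ := x₀)
    (fun z ↦ ‖riemGrad E (objective f) z.1‖ ^ 2)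
  refine ⟨hint, ?_⟩
  rw [heq]
  set Φ : TangentBundle 𝓘(ℝ, E) M → ℝ := potential f fstar η p with hΦ
  set G : TangentBundle 𝓘(ℝ, E) M → ℝ := fun z ↦ ‖riemGrad E (objective f) z.1‖ ^ 2 with hG
  have hstep : ∀ k, ∫ o, Φ (rpage E f η x₀ (fun j ↦ ξ j o) (k + 1)) ∂P ≤
      ∫ o, Φ (rpage E f η x₀ (fun j ↦ ξ j o) k) ∂P
        - η / 2 * ∫ o, G (rpage E f η x₀ (fun j ↦ ξ j o) k) ∂P := by
    intro k
    have hΦi := hsamp.integrable_rpage (E := E) (f := f) (η := η) (x₀ := x₀) k Φ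
    have hGi := hsamp.integrable_rpage (E := E) (f := f) (η := η) (x₀ := x₀) k G
    rw [hsamp.integral_rpage_succ k Φ, ← integral_const_mul,
      ← integral_sub hΦi (hGi.const_mul _)]
    refine integral_mono (hsamp.integrable_rpage k
      (fun z ↦ ∫ s, Φ (rpageStep f η z s) ∂(sampleLaw _ _ b p))) (hΦi.sub (hGi.const_mul _))
      fun o ↦ ?_
    exact integral_potential_rpageStep_le hM hL hf hp₀ hp₁ hb₀ hb hη₀ hη _
  have hsum : ∀ k, ∫ o, Φ (rpage E f η x₀ (fun j ↦ ξ j o) k) ∂P + η / 2 *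
      ∑ j ∈ Finset.range k, ∫ o, G (rpage E f η x₀ (fun j ↦ ξ j o) j) ∂P ≤
      objective f x₀ - fstar := by
    intro k
    induction k with
    | zero =>
      -- The first estimator uses a minibatch of all `n` indices, so the error term of the potential
      -- is zero.
      have h0 : ∀ o, Φ (rpage E f η x₀ (fun j ↦ ξ j o) 0) = objective f x₀ - fstar := by
        intro o
        simp only [hΦ, potential, rpage, batchGrad_full fun i ↦ (hf i).1]
        simp
      simp [h0]
    | succ k ih =>
      rw [Finset.sum_range_succ, mul_add]
      linarith [hstep k]
  -- This is where the lower bound `fstar` enters: it lets the final potential be dropped.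
  have hpos : 0 ≤ ∫ o, Φ (rpage E f η x₀ (fun j ↦ ξ j o) K) ∂P :=
    integral_nonneg fun o ↦ add_nonneg (sub_nonneg.2 (hfstar _)) (by positivity)
  have hK' : (0 : ℝ) < K := by exact_mod_cast hK
  have hfin := hsum K
  rw [le_div_iff₀ (by positivity)]
  have hKK : (K : ℝ)⁻¹ * (∑ j ∈ Finset.range K, ∫ o, G (rpage E f η x₀ (fun j ↦ ξ j o) j) ∂P)
      * (η * K) = η * ∑ j ∈ Finset.range K, ∫ o, G (rpage E f η x₀ (fun j ↦ ξ j o) j) ∂P := by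
    field_simp
  rw [hKK]
  linarith
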